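/- Write $(a,b)=\Re(a\bar b)$ for $a,b\in\mathbb C$. For smooth $\Phi:\mathbb R^{1+3}\to\mathbb C$ and a smooth real one-form $A=\sum_{j=0}^3A_jdx^j$ on $\mathbb R^{1+3}$ (coordinates $(t,x_1,x_2,z)$, $y=(x_1,x_2)$) put $D_j=\partial_j-iA_j$, $\mathcal F_{jk}=\partial_jA_k-\partial_kA_j$, $$S_\varphi[\Phi,A]=D_0D_0\Phi-\sum_{j=1}^3D_jD_j\Phi+\tfrac12(|\Phi|^2-1)\Phi,\qquad S_{a_j}[\Phi,A]=\partial_0\mathcal F_{0j}-\sum_{k=1}^3\partial_k\mathcal F_{kj}-(i\Phi,D_j\Phi)\quad(0\le j\le 3).$$ **(i)** For all smooth $(\Phi,A)$: $\;(S_\varphi[\Phi,A],i\Phi)+\partial_0S_{a_0}[\Phi,A]-\sum_{j=1}^3\partial_jS_{a_j}[\Phi,A]=0$. An $N$-vortex solution is a smooth finite energy solution $(\phi,\alpha)$, $\alpha=\alpha_1dx^1+\alpha_2dx^2$, on $\mathbb R^2$ of the Bogomolny equations $(D_1+iD_2)\phi=0$, $\mathcal F_{12}+\frac12(|\phi|^2-1)=0$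 (with $D_j=\partial_j-i\alpha_j$) such that $\int\mathcal F_{12}=2\pi N$. The moduli space $M_N\cong\mathbb C^N$ of $N$-vortex solutions up to gauge is parametrized by the coefficients of the monic polynomial whose roots are the zeros of $\phi$ with multiplicity. A pair $(\tilde\varphi,\tilde a)$ on $\mathbb R^2$ satisfies the gauge orthogonality condition with respect to $(\phi,\alpha)$ if $\nabla\cdot\tilde a-(i\phi,\tilde\varphi)=\partial_1\tilde a_1+\partial_2\tilde a_2-(i\phi,\tilde\varphi)=0$. The linearization of the static equations at $(\phi,\alpha)$ is the operator $\mathcal L$ whose components on $\psi=(\tilde\varphi,\tilde a_1,\tilde a_2)$ are $$-\sum_{i=1}^2\big(D_i^2\tilde\varphi-2i\tilde a_iD_i\phi\big)+\tfrac12(3|\phi|^2-1)\tilde\varphi+i\phi\big(\nabla\cdot\tilde a-(i\phi,\tilde\varphi)\big),$$ $$-\Delta_y\tilde a_j+|\phi|^2\tilde a_j-2(i\tilde\varphi,D_j\phi)+\partial_j\big(\nabla\cdot\tilde a-(i\phi,\tilde\varphi)\big)\quad(j=1,2).$$ Let $T_*>0$, let $q:[0,T_*]\times\mathbb R\to M_N$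 be smooth (for instance a wave map), and let $(\phi,\alpha)(y;\tau,\zeta)$, smooth in $(y,\tau,\zeta)$, be for each $(\tau,\zeta)\in[0,T_*]\times\mathbb R$ an $N$-vortex solution representing $q(\tau,\zeta)$. Put $\tilde\partial_0=\partial_\tau$, $\tilde\partial_3=\partial_\zeta$. **(ii)** Let $\tilde a_0,\tilde a_3$ be smooth real functions of $(y,\tau,\zeta)$ such that, for $j=0,3$ and all $\tau,\zeta$, the vector $(\tilde\partial_j\phi-i\phi\tilde a_j,\ \tilde\partial_j\alpha-d\tilde a_j)$ satisfies the gauge orthogonality condition (when $\nabla\cdot\alpha=0$: $\Delta_y\tilde a_j-|\phi|^2\tilde a_j+(i\phi,\tilde\partial_j\phi)=0$). With $\tilde D_j=\tilde\partial_j-i\tilde a_j$, the error vector $$T=\Big((\tilde D_0^2-\tilde D_3^2)\phi,\ \big((\tilde\partial_0^2-\tilde\partial_3^2)\alpha_j-\partial_j(\tilde\partial_0\tilde a_0-\tilde\partial_3\tilde a_3)\big)_{j=1,2}\Big)$$ satisfies the gauge orthogonality condition with respect to $(\phi,\alpha)(\cdot\,;\tau,\zeta)$ for every $(\tau,\zeta)\in[0,T_*]\times\mathbb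 R$. **(iii)** Let $n_\mu=(n_{\mu,\varphi},n_{\mu,1},n_{\mu,2})$, $1\le\mu\le 2N$, be $L^2$-orthonormal zero modes at $(\phi,\alpha)(\cdot\,;\tau,\zeta)$ (smooth $L^2$ solutions of the linearized Bogomolny equations that satisfy the gauge orthogonality condition), smooth in $(y,\tau,\zeta)$. Let $m\ge1$, $\epsilon_0>0$, and let $$\Phi_m=\phi+\sum_{i=1}^m\epsilon^{2i}\varphi_i,\qquad A_{m,j}=\alpha_j+\sum_{i=1}^m\epsilon^{2i}a_{j,i}\ (j=1,2),\qquad A_{m,j}=\sum_{i=1}^m\epsilon^{2i-1}a_{j,i}\ (j=0,3),$$ all functions on the right being smooth, independent of $\epsilon$, and evaluated at $y$, $\tau=\epsilon t$, $\zeta=\epsilon z$. Suppose that on $[0,T_*/\epsilon]\times\mathbb R^3$, for $0<\epsilon<\epsilon_0$, the errors $S_\varphi,S_{a_1},S_{a_2}$ at $(\Phi_m,A_m)$ are of the form $\sum_{i=m+1}^{3m}\epsilon^{2i}f_i(\tau,y,\zeta)$, and $S_{a_0},S_{a_3}$ are of the form $\sum_{i=m+1}^{3m}\epsilon^{2i-1}g_i(\tau,y,\zeta)$.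 Let $c_\mu(\tau,\zeta)$ be smooth, and for $\psi_{m+1}=(\varphi_{m+1},a_{1,m+1},a_{2,m+1})$ put $$\Phi_{m+1}=\Phi_m+\epsilon^{2m}\sum_\mu c_\mu n_{\mu,\varphi}+\epsilon^{2m+2}\varphi_{m+1},\qquad A_{m+1,j}=A_{m,j}+\epsilon^{2m}\sum_\mu c_\mu n_{\mu,j}+\epsilon^{2m+2}a_{j,m+1}\ (j=1,2),$$ $$A_{m+1,j}=A_{m,j}+\epsilon^{2m+1}a_{j,m+1}\ (j=0,3),$$ where the smooth functions $a_{0,m+1},a_{3,m+1}$ are such that, for $\psi_{m+1}=0$, $S_{a_0}$ and $S_{a_3}$ at $(\Phi_{m+1},A_{m+1})$ are of the form $\sum_{i=m+2}^{3(m+1)}\epsilon^{2i-1}h_i(\tau,y,\zeta)$. Then there is a smooth vector $S_{m+1}(\tau,y,\zeta)$, independent of $\epsilon$ and $\psi_{m+1}$, such that for every smooth $\psi_{m+1}$ $$(S_\varphi,S_{a_1},S_{a_2})[\Phi_{m+1},A_{m+1}]=\epsilon^{2m+2}\big(\mathcal L\psi_{m+1}+S_{m+1}\big)+\sum_{i=m+2}^{3(m+1)}\epsilon^{2i}r_i(\tau,y,\zeta)\qquad(0<\epsilon<\epsilon_0)$$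 for some $r_i$ independent of $\epsilon$, and $S_{m+1}$ satisfies the gauge orthogonality condition with respect to $(\phi,\alpha)(\cdot\,;\tau,\zeta)$ for every $(\tau,\zeta)\in[0,T_*]\times\mathbb R$. -/

import Mathlib

open scoped ContDiff

noncomputable section

namespace AbelianHiggs

/-- The plane of the variable `y = (x₁, x₂)`. -/
abbrev Plane := Fin 2 → ℝ

/-- Points `(t, x₁, x₂, z)` of `ℝ^{1+3}`, or points `(τ, x₁, x₂, ζ)` in the slow variables. -/
abbrev Spacetime := Fin 4 → ℝ

/-- `(a, b) = Re (a * conj b)`. -/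
def pairing (a b : ℂ) : ℝ := (a * (starRingEnd ℂ) b).re

section Dynamic

variable {E : Type*} [NormedAddCommGroup E] [NormedSpace ℝ E]

/-- The region `0 ≤ x₀ ≤ T` of `ℝ^{1+3}`. -/
def slab (T : ℝ) : Set Spacetime := {x | x 0 ∈ Set.Icc 0 T}

/-- The partial derivative `∂_μ f`, for `f` defined on the region `D`
(one-sided at the boundary of a slab). -/
def pd (D : Set Spacetime) (μ : Fin 4) (f : Spacetime → E) : Spacetime → E :=
  fun x => fderivWithin ℝ f D x (Pi.single μ 1)

/-- The covariant derivative `(∂_μ - i a) f`, where `a` is the `μ`-th component of the potential. -/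
def covD (D : Set Spacetime) (μ : Fin 4) (a : Spacetime → ℝ) (f : Spacetime → ℂ) :
    Spacetime → ℂ :=
  fun x => pd D μ f x - Complex.I * (a x : ℂ) * f x

/-- `F_{μν} = ∂_μ A_ν - ∂_ν A_μ`. -/
def curv (D : Set Spacetime) (A : Fin 4 → Spacetime → ℝ) (μ ν : Fin 4) : Spacetime → ℝ :=
  fun x => pd D μ (A ν) x - pd D ν (A μ) x

/-- `S_φ[Φ, A] = D₀D₀Φ - ∑_{j=1}^3 D_jD_jΦ + (|Φ|² - 1)Φ/2`. -/
def errHiggs (D : Set Spacetime) (Φ : Spacetime → ℂ) (A : Fin 4 → Spacetime → ℝ) :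
    Spacetime → ℂ :=
  fun x => covD D 0 (A 0) (covD D 0 (A 0) Φ) x
    - ∑ k : Fin 3, covD D k.succ (A k.succ) (covD D k.succ (A k.succ) Φ) x
    + (((1 / 2 : ℝ) * (‖Φ x‖ ^ 2 - 1) : ℝ) : ℂ) * Φ x

/-- `S_{a_j}[Φ, A] = (∂₀F_{0j} - ∑_{k=1}^3 ∂_kF_{kj}) - (iΦ, D_jΦ)` for `j = 0, 1, 2, 3`. -/
def errGauge (D : Set Spacetime) (Φ : Spacetime → ℂ) (A : Fin 4 → Spacetime → ℝ) (j : Fin 4) :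
    Spacetime → ℝ :=
  fun x => (pd D 0 (curv D A 0 j) x - ∑ k : Fin 3, pd D k.succ (curv D A k.succ j) x)
    - pairing (Complex.I * Φ x) (covD D j (A j) Φ x)

/-- The index in `Fin 4` of the `j`-th coordinate of the plane. -/
def planeIdx (j : Fin 2) : Fin 4 := ![1, 2] j

/-- The function `y ↦ f (τ, y, ζ)` on the plane. -/
def slice (f : Spacetime → E) (τ ζ : ℝ) : Plane → E := fun y => f ![τ, y 0, y 1, ζ]

/-- The plane coordinates of a point. -/
def planePart (p : Spacetime) : Plane := ![p 1, p 2]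

/-- The point `(εt, x₁, x₂, εz)`. -/
def slow (ε : ℝ) (x : Spacetime) : Spacetime := ![ε * x 0, x 1, x 2, ε * x 3]

/-- On `[0, T/ε] × ℝ³` and for `0 < ε < ε₀`, the family `F` is a finite sum
`F ε (t, x) = ∑_{i = lo}^{hi} ε ^ (e i) • f_i(εt, y, εz)` with `f_i` independent of `ε`. -/
def HasExpansion (T ε₀ : ℝ) (F : ℝ → Spacetime → E) (e : ℕ → ℕ) (lo hi : ℕ) : Prop :=
  ∃ f : ℕ → Spacetime → E, ∀ ε ∈ Set.Ioo 0 ε₀, ∀ x ∈ slab (T / ε),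
    F ε x = ∑ i ∈ Finset.Icc lo hi, ε ^ (e i) • f i (slow ε x)

end Dynamic

section Static

variable {E : Type*} [NormedAddCommGroup E] [NormedSpace ℝ E]

/-- Partial derivatives on the plane. -/
def pd2 (j : Fin 2) (f : Plane → E) : Plane → E := fun y => fderiv ℝ f y (Pi.single j 1)

/-- `D_j f = ∂_j f - i α_j f` on the plane. -/
def covD2 (α : Fin 2 → Plane → ℝ) (j : Fin 2) (f : Plane → ℂ) : Plane → ℂ :=
  fun y => pd2 j f y - Complex.I * (α j y : ℂ) * f y

/-- `F₁₂ = ∂₁α₂ - ∂₂α₁`. -/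
def curv2 (α : Fin 2 → Plane → ℝ) : Plane → ℝ := fun y => pd2 0 (α 1) y - pd2 1 (α 0) y

/-- The left-hand side `∇·ã - (iφ, φ̃)` of the gauge orthogonality condition. -/
def gaugeDefect (φ φt : Plane → ℂ) (at' : Fin 2 → Plane → ℝ) : Plane → ℝ :=
  fun y => ∑ j, pd2 j (at' j) y - pairing (Complex.I * φ y) (φt y)

/-- The gauge orthogonality condition with respect to `φ`. -/
def GaugeOrthogonal (φ φt : Plane → ℂ) (at' : Fin 2 → Plane → ℝ) : Prop :=
  ∀ y, gaugeDefect φ φt at' y = 0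

/-- `N`-vortex solutions: smooth finite energy solutions of the Bogomolny equations (positive sign)
with `∫ F₁₂ = 2πN`. -/
structure IsVortex (N : ℕ) (φ : Plane → ℂ) (α : Fin 2 → Plane → ℝ) : Prop where
  smooth_higgs : ContDiff ℝ ∞ φ
  smooth_gauge : ∀ j, ContDiff ℝ ∞ (α j)
  bogomolny_higgs : ∀ y, covD2 α 0 φ y + Complex.I * covD2 α 1 φ y = 0
  bogomolny_gauge : ∀ y, curv2 α y + (1 / 2) * (‖φ y‖ ^ 2 - 1) = 0
  finite_energy : MeasureTheory.Integrable (fun y : Plane =>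
    ∑ j, ‖covD2 α j φ y‖ ^ 2 + curv2 α y ^ 2 + (1 / 4) * (‖φ y‖ ^ 2 - 1) ^ 2)
  integrable_curv : MeasureTheory.Integrable (curv2 α)
  charge : ∫ y, curv2 α y = 2 * Real.pi * N

/-- The monic polynomial `z^N + S_{N-1} z^{N-1} + ⋯ + S₀` whose roots are the vortex centres.
The coefficients `S ∈ ℂ^N` are the coordinates on the moduli space `M_N`. -/
def vortexPoly {N : ℕ} (S : Fin N → ℂ) (z : ℂ) : ℂ := z ^ N + ∑ j : Fin N, S j * z ^ (j : ℕ)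

/-- `(φ, α)` is an `N`-vortex solution in the gauge class with moduli coordinates `S`: the zeros of
`φ`, with multiplicity, are the roots of the polynomial with coefficients `S`. -/
def Represents {N : ℕ} (S : Fin N → ℂ) (φ : Plane → ℂ) (α : Fin 2 → Plane → ℝ) : Prop :=
  IsVortex N φ α ∧ ∃ g : Plane → ℂ, ContDiff ℝ ∞ g ∧ (∀ y, g y ≠ 0) ∧
    ∀ y, φ y = vortexPoly S ((y 0 : ℂ) + Complex.I * (y 1 : ℂ)) * g y

/-- Zero modes at `(φ, α)`: smooth `L²` solutions of the linearized Bogomolny equations that satisfy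
the gauge orthogonality condition. -/
structure IsZeroMode (φ : Plane → ℂ) (α : Fin 2 → Plane → ℝ)
    (nφ : Plane → ℂ) (na : Fin 2 → Plane → ℝ) : Prop where
  smooth_higgs : ContDiff ℝ ∞ nφ
  smooth_gauge : ∀ j, ContDiff ℝ ∞ (na j)
  memLp_higgs : MeasureTheory.MemLp nφ 2
  memLp_gauge : ∀ j, MeasureTheory.MemLp (na j) 2
  linearized_higgs : ∀ y, covD2 α 0 nφ y + Complex.I * covD2 α 1 nφ y
    - Complex.I * ((na 0 y : ℂ) + Complex.I * (na 1 y : ℂ)) * φ y = 0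
  linearized_gauge : ∀ y, curv2 na y + pairing (φ y) (nφ y) = 0
  gauge_orthogonal : GaugeOrthogonal φ nφ na

/-- The Higgs component of the linearized operator `𝓛[φ, α](φ̃, ã)`. -/
def linHiggs (φ : Plane → ℂ) (α : Fin 2 → Plane → ℝ) (φt : Plane → ℂ)
    (at' : Fin 2 → Plane → ℝ) : Plane → ℂ :=
  fun y => -∑ j, (covD2 α j (covD2 α j φt) y
      - 2 * Complex.I * (at' j y : ℂ) * covD2 α j φ y)
    + (((1 / 2 : ℝ) * (3 * ‖φ y‖ ^ 2 - 1) : ℝ) : ℂ) * φt y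
    + Complex.I * φ y * (gaugeDefect φ φt at' y : ℂ)

/-- The gauge field components of the linearized operator `𝓛[φ, α](φ̃, ã)`. -/
def linGauge (φ : Plane → ℂ) (α : Fin 2 → Plane → ℝ) (φt : Plane → ℂ)
    (at' : Fin 2 → Plane → ℝ) (j : Fin 2) : Plane → ℝ :=
  fun y => -∑ k, pd2 k (pd2 k (at' j)) y + ‖φ y‖ ^ 2 * at' j y
    - 2 * pairing (Complex.I * φt y) (covD2 α j φ y)
    + pd2 j (gaugeDefect φ φt at') y

end Static

section Ansatz

/-- `(φ, α)(y; τ, ζ)` is a smooth family of `N`-vortex solutions over `[0, T] × ℝ` that represents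
the smooth map `q : [0, T] × ℝ → M_N`. The representatives may be in any gauge. -/
structure IsVortexLift {N : ℕ} (T : ℝ) (q : ℝ × ℝ → Fin N → ℂ)
    (φ : Spacetime → ℂ) (α : Fin 2 → Spacetime → ℝ) : Prop where
  smooth_map : ContDiffOn ℝ ∞ q (Set.Icc 0 T ×ˢ Set.univ)
  smooth_higgs : ContDiffOn ℝ ∞ φ (slab T)
  smooth_gauge : ∀ j, ContDiffOn ℝ ∞ (α j) (slab T)
  represents : ∀ τ ∈ Set.Icc 0 T, ∀ ζ : ℝ,
    Represents (q (τ, ζ)) (slice φ τ ζ) (fun j => slice (α j) τ ζ)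

/-- For `j = 0` or `j = 3` (`∂̃₀ = ∂_τ`, `∂̃₃ = ∂_ζ`), the function `a` is an admissible `ã_j`: it is
smooth, and `(∂̃_jφ - iφ a, ∂̃_jα - d a)` satisfies the gauge orthogonality condition for all `τ, ζ`.
When `∂₁α₁ + ∂₂α₂ = 0` this is the equation `Δ_y a - |φ|² a + (iφ, ∂̃_jφ) = 0`. -/
def IsTemporalPotential (T : ℝ) (φ : Spacetime → ℂ) (α : Fin 2 → Spacetime → ℝ)
    (j : Fin 4) (a : Spacetime → ℝ) : Prop :=
  ContDiffOn ℝ ∞ a (slab T) ∧ ∀ τ ∈ Set.Icc 0 T, ∀ ζ : ℝ,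
    GaugeOrthogonal (slice φ τ ζ) (slice (covD (slab T) j a φ) τ ζ)
      (fun k => slice (fun p => pd (slab T) j (α k) p - pd (slab T) (planeIdx k) a p) τ ζ)

/-- The Higgs component `(D̃₀² - D̃₃²)φ` of the error vector `T`, with `D̃_j = ∂̃_j - iã_j`. -/
def errorTHiggs (T : ℝ) (φ : Spacetime → ℂ) (a₀ a₃ : Spacetime → ℝ) : Spacetime → ℂ :=
  fun p => covD (slab T) 0 a₀ (covD (slab T) 0 a₀ φ) p
    - covD (slab T) 3 a₃ (covD (slab T) 3 a₃ φ) p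

/-- The gauge field components `(∂̃₀² - ∂̃₃²)α_j - ∂_j(∂̃₀ã₀ - ∂̃₃ã₃)` of the error vector `T`. -/
def errorTGauge (T : ℝ) (α : Fin 2 → Spacetime → ℝ) (a₀ a₃ : Spacetime → ℝ) (j : Fin 2) :
    Spacetime → ℝ :=
  fun p => pd (slab T) 0 (pd (slab T) 0 (α j)) p - pd (slab T) 3 (pd (slab T) 3 (α j)) p
    - pd (slab T) (planeIdx j) (fun p' => pd (slab T) 0 a₀ p' - pd (slab T) 3 a₃ p') p

/-- `(n_μ)`, `μ = 1, …, 2N`, is a smooth family of `L²`-orthonormal frames of zero modes along the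
family `(φ, α)`. -/
structure IsZeroModeFrame (N : ℕ) (T : ℝ) (φ : Spacetime → ℂ) (α : Fin 2 → Spacetime → ℝ)
    (nφ : Fin (2 * N) → Spacetime → ℂ) (na : Fin (2 * N) → Fin 2 → Spacetime → ℝ) : Prop where
  smooth_higgs : ∀ μ, ContDiffOn ℝ ∞ (nφ μ) (slab T)
  smooth_gauge : ∀ μ j, ContDiffOn ℝ ∞ (na μ j) (slab T)
  zero_mode : ∀ μ, ∀ τ ∈ Set.Icc 0 T, ∀ ζ : ℝ,
    IsZeroMode (slice φ τ ζ) (fun j => slice (α j) τ ζ)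
      (slice (nφ μ) τ ζ) (fun j => slice (na μ j) τ ζ)
  orthonormal : ∀ μ ν, ∀ τ ∈ Set.Icc 0 T, ∀ ζ : ℝ,
    ∫ y, (pairing (slice (nφ μ) τ ζ y) (slice (nφ ν) τ ζ y)
      + ∑ j, slice (na μ j) τ ζ y * slice (na ν j) τ ζ y) = if μ = ν then 1 else 0

/-- `Φ_m(t, x) = φ(y; εt, εz) + ∑_{i=1}^m ε^{2i} φ_i(εt, y, εz)`. -/
def ansatzHiggs (φ : Spacetime → ℂ) (φs : ℕ → Spacetime → ℂ) (m : ℕ) (ε : ℝ) : Spacetime → ℂ :=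
  fun x => φ (slow ε x) + ∑ i ∈ Finset.Icc 1 m, ε ^ (2 * i) • φs i (slow ε x)

/-- `A_{m,j}(t, x) = α_j(y; εt, εz) + ∑_{i=1}^m ε^{2i} a_{j,i}(εt, y, εz)` for `j = 1, 2` and
`A_{m,j}(t, x) = ∑_{i=1}^m ε^{2i-1} a_{j,i}(εt, y, εz)` for `j = 0, 3`. -/
def ansatzGauge (α : Fin 2 → Spacetime → ℝ) (as : Fin 4 → ℕ → Spacetime → ℝ) (m : ℕ) (ε : ℝ) :
    Fin 4 → Spacetime → ℝ :=
  ![fun x => ∑ i ∈ Finset.Icc 1 m, ε ^ (2 * i - 1) * as 0 i (slow ε x),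
    fun x => α 0 (slow ε x) + ∑ i ∈ Finset.Icc 1 m, ε ^ (2 * i) * as 1 i (slow ε x),
    fun x => α 1 (slow ε x) + ∑ i ∈ Finset.Icc 1 m, ε ^ (2 * i) * as 2 i (slow ε x),
    fun x => ∑ i ∈ Finset.Icc 1 m, ε ^ (2 * i - 1) * as 3 i (slow ε x)]

/-- The functions `φ_i`, `a_{j,i}`, `1 ≤ i ≤ m`, form an approximate solution `(Φ_m, A_m)` of order
`m`: they are smooth, `S_φ`, `S_{a_1}`, `S_{a_2}` at `(Φ_m, A_m)` are of the form
`∑_{i=m+1}^{3m} ε^{2i} f_i` and `S_{a_0}`, `S_{a_3}` are of the form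
`∑_{i=m+1}^{3m} ε^{2i-1} g_i`. -/
structure IsApproxSolution (T ε₀ : ℝ) (φ : Spacetime → ℂ) (α : Fin 2 → Spacetime → ℝ) (m : ℕ)
    (φs : ℕ → Spacetime → ℂ) (as : Fin 4 → ℕ → Spacetime → ℝ) : Prop where
  smooth_higgs : ∀ i ∈ Finset.Icc 1 m, ContDiffOn ℝ ∞ (φs i) (slab T)
  smooth_gauge : ∀ j, ∀ i ∈ Finset.Icc 1 m, ContDiffOn ℝ ∞ (as j i) (slab T)
  error_higgs : HasExpansion T ε₀
    (fun ε => errHiggs (slab (T / ε)) (ansatzHiggs φ φs m ε) (ansatzGauge α as m ε))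
    (fun i => 2 * i) (m + 1) (3 * m)
  error_plane : ∀ j : Fin 2, HasExpansion T ε₀
    (fun ε => errGauge (slab (T / ε)) (ansatzHiggs φ φs m ε) (ansatzGauge α as m ε) (planeIdx j))
    (fun i => 2 * i) (m + 1) (3 * m)
  error_zero : HasExpansion T ε₀
    (fun ε => errGauge (slab (T / ε)) (ansatzHiggs φ φs m ε) (ansatzGauge α as m ε) 0)
    (fun i => 2 * i - 1) (m + 1) (3 * m)
  error_three : HasExpansion T ε₀
    (fun ε => errGauge (slab (T / ε)) (ansatzHiggs φ φs m ε) (ansatzGauge α as m ε) 3)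
    (fun i => 2 * i - 1) (m + 1) (3 * m)

/-- `Φ_{m+1} = Φ_m + ε^{2m} ∑_μ c_μ(εt, εz) n_{μ,φ} + ε^{2m+2} φ_{m+1}`. -/
def stepHiggs {N : ℕ} (φ : Spacetime → ℂ) (φs : ℕ → Spacetime → ℂ) (m : ℕ)
    (c : Fin (2 * N) → ℝ × ℝ → ℝ) (nφ : Fin (2 * N) → Spacetime → ℂ)
    (ψφ : Spacetime → ℂ) (ε : ℝ) : Spacetime → ℂ :=
  fun x => ansatzHiggs φ φs m ε x
    + ε ^ (2 * m) • ∑ μ, c μ (ε * x 0, ε * x 3) • nφ μ (slow ε x)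
    + ε ^ (2 * m + 2) • ψφ (slow ε x)

/-- `A_{m+1,j} = A_{m,j} + ε^{2m} ∑_μ c_μ(εt, εz) n_{μ,j} + ε^{2m+2} a_{j,m+1}` for `j = 1, 2` and
`A_{m+1,j} = A_{m,j} + ε^{2m+1} a_{j,m+1}` for `j = 0, 3`. Here `ψa` stands for
`(a_{1,m+1}, a_{2,m+1})` and `b₀`, `b₃` stand for `a_{0,m+1}`, `a_{3,m+1}`. -/
def stepGauge {N : ℕ} (α : Fin 2 → Spacetime → ℝ) (as : Fin 4 → ℕ → Spacetime → ℝ) (m : ℕ)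
    (c : Fin (2 * N) → ℝ × ℝ → ℝ) (na : Fin (2 * N) → Fin 2 → Spacetime → ℝ)
    (b₀ b₃ : Spacetime → ℝ) (ψa : Fin 2 → Spacetime → ℝ) (ε : ℝ) : Fin 4 → Spacetime → ℝ :=
  ![fun x => ansatzGauge α as m ε 0 x + ε ^ (2 * m + 1) * b₀ (slow ε x),
    fun x => ansatzGauge α as m ε 1 x
      + ε ^ (2 * m) * ∑ μ, c μ (ε * x 0, ε * x 3) * na μ 0 (slow ε x)
      + ε ^ (2 * m + 2) * ψa 0 (slow ε x),
    fun x => ansatzGauge α as m ε 2 x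
      + ε ^ (2 * m) * ∑ μ, c μ (ε * x 0, ε * x 3) * na μ 1 (slow ε x)
      + ε ^ (2 * m + 2) * ψa 1 (slow ε x),
    fun x => ansatzGauge α as m ε 3 x + ε ^ (2 * m + 1) * b₃ (slow ε x)]

/-- `(Sφ, Sa)` is the vector `S_{m+1}`: it does not depend on `ε` or on
`ψ_{m+1} = (φ_{m+1}, a_{1,m+1}, a_{2,m+1})`, and for every smooth `ψ_{m+1}`
`(S_φ, S_{a_1}, S_{a_2})[Φ_{m+1}, A_{m+1}] = ε^{2m+2}(𝓛ψ_{m+1} + S_{m+1}) + ε^{2m+4}(⋯) + ⋯`,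
where the powers of `ε` are even and at most `6(m+1)`. -/
def IsStepError {N : ℕ} (T ε₀ : ℝ) (φ : Spacetime → ℂ) (α : Fin 2 → Spacetime → ℝ) (m : ℕ)
    (φs : ℕ → Spacetime → ℂ) (as : Fin 4 → ℕ → Spacetime → ℝ)
    (c : Fin (2 * N) → ℝ × ℝ → ℝ) (nφ : Fin (2 * N) → Spacetime → ℂ)
    (na : Fin (2 * N) → Fin 2 → Spacetime → ℝ) (b₀ b₃ : Spacetime → ℝ)
    (Sφ : Spacetime → ℂ) (Sa : Fin 2 → Spacetime → ℝ) : Prop :=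
  ∀ (ψφ : Spacetime → ℂ) (ψa : Fin 2 → Spacetime → ℝ),
    ContDiffOn ℝ ∞ ψφ (slab T) → (∀ j, ContDiffOn ℝ ∞ (ψa j) (slab T)) →
    HasExpansion T ε₀
      (fun ε x =>
        errHiggs (slab (T / ε)) (stepHiggs φ φs m c nφ ψφ ε)
          (stepGauge α as m c na b₀ b₃ ψa ε) x
        - ε ^ (2 * m + 2) • (linHiggs (slice φ (ε * x 0) (ε * x 3))
              (fun k => slice (α k) (ε * x 0) (ε * x 3)) (slice ψφ (ε * x 0) (ε * x 3))
              (fun k => slice (ψa k) (ε * x 0) (ε * x 3)) (planePart x) + Sφ (slow ε x)))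
      (fun i => 2 * i) (m + 2) (3 * (m + 1)) ∧
    ∀ j : Fin 2, HasExpansion T ε₀
      (fun ε x =>
        errGauge (slab (T / ε)) (stepHiggs φ φs m c nφ ψφ ε)
          (stepGauge α as m c na b₀ b₃ ψa ε) (planeIdx j) x
        - ε ^ (2 * m + 2) * (linGauge (slice φ (ε * x 0) (ε * x 3))
              (fun k => slice (α k) (ε * x 0) (ε * x 3)) (slice ψφ (ε * x 0) (ε * x 3))
              (fun k => slice (ψa k) (ε * x 0) (ε * x 3)) j (planePart x) + Sa j (slow ε x)))
      (fun i => 2 * i) (m + 2) (3 * (m + 1))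

end Ansatz

end AbelianHiggs

end

open AbelianHiggs

/-! Everything rests on the Noether identity of gauge invariance. The divergence of the current (iΦ,
D_jΦ) has the terms (iΦ, D_jD_jΦ), the double divergence of a curvature vanishes by antisymmetry,
and a real multiple of Φ pairs to zero with iΦ. Hence the identity holds for every diagonal metric
with constant entries, on a closed slab as well as on the whole space
(`RegularDomain.gauge_identity`); (i) is the Minkowski case.

For (ii), the identity is applied in the slow variables to φ with the potential (ã₀, α₁, α₂, ã₃).
The static second order equations, consequences of the Bogomolny equations, drop out of the Higgs
and planar components and leave T. Orthogonality of the two velocities cancels everything in the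
components 0 and 3 except ∂₃F₀₃ and ∂₀F₀₃, whose contributions ∂₀∂₃F₀₃ - ∂₃∂₀F₀₃ cancel. What
remains is the orthogonality of T.

For (iii), put s = ε², pass to the slow variables and take a factor ε out of A₀ and A₃. The errors
become field equations with weights (s, -1, -1, -s), polynomial in s with smooth coefficients
(`errHiggs_slow`, `errGauge_slow`). A perturbation of size s^k, k ≥ 1, changes the Higgs and planar
components by s^k times 𝓛 of its Higgs and planar part, up to O(s^(k+1))
(`IsVariation.weightedHiggs`, `IsVariation.weightedGauge`); the components 0 and 3 of the potential
do not contribute at this order because of the weight s. For k = m the perturbation is a combination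
of zero modes, which 𝓛 kills (`IsZeroModeFrame.lin_sum_eq_zero`), so the error stays O(s^(m+1)) and
S_{m+1} is its leading coefficient; for k = m + 1 the term 𝓛ψ_{m+1} appears. Finally, the components
0 and 3 enter the weighted identity with an extra factor s, hence at order s^(m+2), and its
coefficient at s^(m+1) is the orthogonality of S_{m+1} (`gaugeOrthogonal_leading`). -/

noncomputable section

namespace AbelianHiggs

/-! ### One-sided partial derivatives and their rules. -/

section Calculus

variable {E F : Type*} [NormedAddCommGroup E] [NormedSpace ℝ E]
  [NormedAddCommGroup F] [NormedSpace ℝ F]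

/-- Domains on which one-sided partial derivatives are unique and commute. -/
structure RegularDomain (D : Set Spacetime) : Prop where
  uniqueDiffOn : UniqueDiffOn ℝ D
  subset_closure : D ⊆ closure (interior D)

theorem regularDomain_univ : RegularDomain Set.univ :=
  ⟨uniqueDiffOn_univ, by simp⟩

theorem convex_slab (T : ℝ) : Convex ℝ (slab T) :=
  (convex_Icc (0 : ℝ) T).linear_preimage (LinearMap.proj (R := ℝ) (φ := fun _ : Fin 4 => ℝ) 0)

theorem interior_slab_nonempty {T : ℝ} (hT : 0 < T) : (interior (slab T)).Nonempty := by
  refine ⟨fun _ => T / 2, mem_interior.2 ⟨{x | x 0 ∈ Set.Ioo 0 T}, ?_, ?_, ?_⟩⟩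
  · exact fun x hx => Set.Ioo_subset_Icc_self hx
  · exact isOpen_Ioo.preimage (continuous_apply (0 : Fin 4))
  · exact ⟨by positivity, by simpa using hT⟩

theorem regularDomain_slab {T : ℝ} (hT : 0 < T) : RegularDomain (slab T) where
  uniqueDiffOn := uniqueDiffOn_convex (convex_slab T) (interior_slab_nonempty hT)
  subset_closure := by
    rw [(convex_slab T).closure_interior_eq_closure_of_nonempty_interior
      (interior_slab_nonempty hT)]
    exact subset_closure

variable {D : Set Spacetime} {f g : Spacetime → E} {x : Spacetime}

theorem _root_.ContDiffOn.differentiableWithinAt_infty (hf : ContDiffOn ℝ ∞ f D) (hx : x ∈ D) :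
    DifferentiableWithinAt ℝ f D x :=
  hf.differentiableOn (by simp) x hx

theorem pd_congr (μ : Fin 4) (h : Set.EqOn f g D) (hx : x ∈ D) : pd D μ f x = pd D μ g x := by
  simp only [pd, fderivWithin_congr h (h hx)]

theorem covD_congr (μ : Fin 4) (a : Spacetime → ℝ) {f g : Spacetime → ℂ} (h : Set.EqOn f g D)
    (hx : x ∈ D) : covD D μ a f x = covD D μ a g x := by
  simp only [covD, pd_congr μ h hx, h hx]

theorem pd_eq_zero (μ : Fin 4) (h : ∀ y ∈ D, f y = 0) (hx : x ∈ D) : pd D μ f x = 0 := by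
  rw [pd_congr μ (g := fun _ => 0) h hx]
  simp [pd]

theorem pd_const (μ : Fin 4) (c : E) : pd D μ (fun _ => c) x = 0 := by
  simp [pd]

section

variable (hD : RegularDomain D)
include hD

theorem RegularDomain.contDiffOn_pd (μ : Fin 4) (hf : ContDiffOn ℝ ∞ f D) :
    ContDiffOn ℝ ∞ (pd D μ f) D :=
  (hf.fderivWithin hD.uniqueDiffOn (by simp)).clm_apply contDiffOn_const

theorem RegularDomain.pd_add (μ : Fin 4) (hf : ContDiffOn ℝ ∞ f D) (hg : ContDiffOn ℝ ∞ g D)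
    (hx : x ∈ D) : pd D μ (fun y => f y + g y) x = pd D μ f x + pd D μ g x := by
  simp only [pd]
  rw [fderivWithin_fun_add (hD.uniqueDiffOn x hx) (hf.differentiableWithinAt_infty hx)
    (hg.differentiableWithinAt_infty hx)]
  rfl

theorem RegularDomain.pd_sub (μ : Fin 4) (hf : ContDiffOn ℝ ∞ f D) (hg : ContDiffOn ℝ ∞ g D)
    (hx : x ∈ D) : pd D μ (fun y => f y - g y) x = pd D μ f x - pd D μ g x := by
  simp only [pd]
  rw [fderivWithin_fun_sub (hD.uniqueDiffOn x hx) (hf.differentiableWithinAt_infty hx)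
    (hg.differentiableWithinAt_infty hx)]
  rfl

theorem RegularDomain.pd_sum {ι : Type*} (s : Finset ι) {f : ι → Spacetime → E} (μ : Fin 4)
    (hf : ∀ i ∈ s, ContDiffOn ℝ ∞ (f i) D) (hx : x ∈ D) :
    pd D μ (fun y => ∑ i ∈ s, f i y) x = ∑ i ∈ s, pd D μ (f i) x := by
  simp only [pd]
  rw [fderivWithin_fun_sum (hD.uniqueDiffOn x hx)
    (fun i hi => (hf i hi).differentiableWithinAt_infty hx)]
  simp

theorem RegularDomain.pd_clm (L : E →L[ℝ] F) (μ : Fin 4) (hf : ContDiffOn ℝ ∞ f D)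
    (hx : x ∈ D) : pd D μ (fun y => L (f y)) x = L (pd D μ f x) := by
  simp only [pd]
  have := (L.hasFDerivAt.comp_hasFDerivWithinAt x
    (hf.differentiableWithinAt_infty hx).hasFDerivWithinAt).fderivWithin (hD.uniqueDiffOn x hx)
  rw [show (fun y => L (f y)) = L ∘ f from rfl, this]
  rfl

theorem RegularDomain.pd_smul (c : ℝ) (μ : Fin 4) (hf : ContDiffOn ℝ ∞ f D)
    (hx : x ∈ D) : pd D μ (fun y => c • f y) x = c • pd D μ f x :=
  hD.pd_clm (c • ContinuousLinearMap.id ℝ E) μ hf hx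

theorem RegularDomain.pd_mul {𝔸 : Type*} [NormedCommRing 𝔸] [NormedAlgebra ℝ 𝔸]
    {f g : Spacetime → 𝔸} (μ : Fin 4) (hf : ContDiffOn ℝ ∞ f D) (hg : ContDiffOn ℝ ∞ g D)
    (hx : x ∈ D) :
    pd D μ (fun y => f y * g y) x = f x * pd D μ g x + pd D μ f x * g x := by
  simp only [pd]
  rw [fderivWithin_fun_mul (hD.uniqueDiffOn x hx) (hf.differentiableWithinAt_infty hx)
    (hg.differentiableWithinAt_infty hx)]
  simp [mul_comm]

theorem RegularDomain.pd_const_mul {𝔸 : Type*} [NormedCommRing 𝔸] [NormedAlgebra ℝ 𝔸]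
    {f : Spacetime → 𝔸} (c : 𝔸) (μ : Fin 4) (hf : ContDiffOn ℝ ∞ f D) (hx : x ∈ D) :
    pd D μ (fun y => c * f y) x = c * pd D μ f x :=
  hD.pd_clm (ContinuousLinearMap.mul ℝ 𝔸 c) μ hf hx

theorem RegularDomain.pd_ofReal {f : Spacetime → ℝ} (μ : Fin 4) (hf : ContDiffOn ℝ ∞ f D)
    (hx : x ∈ D) : pd D μ (fun y => (f y : ℂ)) x = ((pd D μ f x : ℝ) : ℂ) :=
  hD.pd_clm Complex.ofRealCLM μ hf hx

/-- Symmetry of the second derivative extends to boundary points, because they are limits of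
interior points and `f` is smooth up to the boundary. -/
theorem RegularDomain.pd_comm (μ ν : Fin 4) (hf : ContDiffOn ℝ ∞ f D) (hx : x ∈ D) :
    pd D μ (pd D ν f) x = pd D ν (pd D μ f) x := by
  have hsymm : IsSymmSndFDerivWithinAt ℝ f D x :=
    (hf x hx).isSymmSndFDerivWithinAt (by
      rw [minSmoothness_of_isRCLikeNormedField]
      exact WithTop.coe_le_coe.2 (le_top : (2 : ℕ∞) ≤ ⊤)) hD.uniqueDiffOn (hD.subset_closure hx) hx
  have hd : DifferentiableWithinAt ℝ (fderivWithin ℝ f D) D x :=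
    (hf.fderivWithin (m := ∞) hD.uniqueDiffOn (by simp)).differentiableWithinAt_infty hx
  have key (κ : Fin 4) (v : Spacetime) : fderivWithin ℝ (fun y => fderivWithin ℝ f D y v) D x
      (Pi.single κ 1) = fderivWithin ℝ (fderivWithin ℝ f D) D x (Pi.single κ 1) v := by
    rw [fderivWithin_clm_apply (hD.uniqueDiffOn x hx) hd (differentiableWithinAt_const v)]
    simp
  exact (key μ _).trans ((hsymm _ _).trans (key ν _).symm)

end

theorem _root_.ContDiffOn.ofReal {f : Spacetime → ℝ} (hf : ContDiffOn ℝ ∞ f D) :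
    ContDiffOn ℝ ∞ (fun y => (f y : ℂ)) D :=
  Complex.ofRealCLM.contDiff.comp_contDiffOn hf

theorem _root_.ContDiffOn.conj {f : Spacetime → ℂ} (hf : ContDiffOn ℝ ∞ f D) :
    ContDiffOn ℝ ∞ (fun y => (starRingEnd ℂ) (f y)) D :=
  (Complex.conjCLE : ℂ →L[ℝ] ℂ).contDiff.comp_contDiffOn hf

theorem _root_.ContDiffOn.pairing {f g : Spacetime → ℂ} (hf : ContDiffOn ℝ ∞ f D)
    (hg : ContDiffOn ℝ ∞ g D) : ContDiffOn ℝ ∞ (fun y => pairing (f y) (g y)) D :=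
  Complex.reCLM.contDiff.comp_contDiffOn (hf.mul hg.conj)

variable (hD : RegularDomain D)
include hD

theorem RegularDomain.pd_pairing {f g : Spacetime → ℂ} (μ : Fin 4) (hf : ContDiffOn ℝ ∞ f D)
    (hg : ContDiffOn ℝ ∞ g D) (hx : x ∈ D) :
    pd D μ (fun y => pairing (f y) (g y)) x
      = pairing (pd D μ f x) (g x) + pairing (f x) (pd D μ g x) := by
  have h1 := hD.pd_clm Complex.reCLM μ (hf.mul hg.conj) hx
  have h2 := hD.pd_clm (Complex.conjCLE : ℂ →L[ℝ] ℂ) μ hg hx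
  have h3 := hD.pd_mul μ hf hg.conj hx
  simp only [pairing]
  change pd D μ (fun y => Complex.reCLM (f y * (starRingEnd ℂ) (g y))) x = _
  rw [h1, h3]
  change (f x * pd D μ (fun y => (Complex.conjCLE : ℂ →L[ℝ] ℂ) (g y)) x + _).re = _
  rw [h2]
  simp
  ring

theorem RegularDomain.contDiffOn_covD {a : Spacetime → ℝ} {f : Spacetime → ℂ} (μ : Fin 4)
    (ha : ContDiffOn ℝ ∞ a D) (hf : ContDiffOn ℝ ∞ f D) : ContDiffOn ℝ ∞ (covD D μ a f) D :=
  (hD.contDiffOn_pd μ hf).sub ((contDiffOn_const.mul ha.ofReal).mul hf)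

theorem RegularDomain.contDiffOn_curv {A : Fin 4 → Spacetime → ℝ} (μ ν : Fin 4)
    (hA : ∀ j, ContDiffOn ℝ ∞ (A j) D) : ContDiffOn ℝ ∞ (curv D A μ ν) D :=
  (hD.contDiffOn_pd μ (hA ν)).sub (hD.contDiffOn_pd ν (hA μ))

theorem RegularDomain.pd_covD {b : Spacetime → ℝ} {f : Spacetime → ℂ} (μ ν : Fin 4)
    (hb : ContDiffOn ℝ ∞ b D) (hf : ContDiffOn ℝ ∞ f D) (hx : x ∈ D) :
    pd D μ (covD D ν b f) x = pd D μ (pd D ν f) x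
      - Complex.I * (b x * pd D μ f x + pd D μ b x * f x) := by
  have h : covD D ν b f = fun y => pd D ν f y - Complex.I * ((b y : ℂ) * f y) := by
    ext y; simp only [covD]; ring
  rw [h, hD.pd_sub μ (hD.contDiffOn_pd ν hf) (contDiffOn_const.mul (hb.ofReal.mul hf)) hx,
    hD.pd_const_mul _ _ (hb.ofReal.mul hf) hx, hD.pd_mul _ hb.ofReal hf hx, hD.pd_ofReal _ hb hx]

/-- Second derivatives cancel by symmetry, and so do the first derivatives of `f` and the product of
the two potentials; only derivatives of the potentials survive. -/
theorem RegularDomain.covD_comm {a b : Spacetime → ℝ} {f : Spacetime → ℂ} (μ ν : Fin 4)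
    (ha : ContDiffOn ℝ ∞ a D) (hb : ContDiffOn ℝ ∞ b D) (hf : ContDiffOn ℝ ∞ f D) (hx : x ∈ D) :
    covD D μ a (covD D ν b f) x - covD D ν b (covD D μ a f) x
      = -Complex.I * ((pd D μ b x - pd D ν a x : ℝ) : ℂ) * f x := by
  have h1 := hD.pd_covD μ ν hb hf hx
  have h2 := hD.pd_covD ν μ ha hf hx
  have h3 := hD.pd_comm μ ν hf hx
  have e1 : covD D μ a (covD D ν b f) x
      = pd D μ (covD D ν b f) x - Complex.I * a x * (pd D ν f x - Complex.I * b x * f x) := rfl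
  have e2 : covD D ν b (covD D μ a f) x
      = pd D ν (covD D μ a f) x - Complex.I * b x * (pd D μ f x - Complex.I * a x * f x) := rfl
  rw [e1, e2, h1, h2, h3]
  push_cast
  ring

end Calculus

/-! ### The gauge identity; the Bogomolny equations and their linearization. -/

section Identities

variable {D : Set Spacetime} {x : Spacetime}

/-- The Higgs component of the field equations for the diagonal metric with entries `w μ`. -/
def weightedHiggs (D : Set Spacetime) (w : Fin 4 → ℝ) (Φ : Spacetime → ℂ)
    (A : Fin 4 → Spacetime → ℝ) : Spacetime → ℂ :=
  fun x => ∑ μ, (w μ : ℂ) * covD D μ (A μ) (covD D μ (A μ) Φ) x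
    + (((1 / 2 : ℝ) * (‖Φ x‖ ^ 2 - 1) : ℝ) : ℂ) * Φ x

/-- The gauge field components of the field equations for the diagonal metric with entries
`w μ`. -/
def weightedGauge (D : Set Spacetime) (w : Fin 4 → ℝ) (Φ : Spacetime → ℂ)
    (A : Fin 4 → Spacetime → ℝ) (j : Fin 4) : Spacetime → ℝ :=
  fun x => ∑ μ, w μ * pd D μ (curv D A μ j) x - pairing (Complex.I * Φ x) (covD D j (A j) Φ x)

theorem errHiggs_eq_weightedHiggs (D : Set Spacetime) (Φ : Spacetime → ℂ)
    (A : Fin 4 → Spacetime → ℝ) : errHiggs D Φ A = weightedHiggs D ![1, -1, -1, -1] Φ A := by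
  ext x
  simp only [errHiggs, weightedHiggs, Fin.sum_univ_succ]
  simp
  ring

theorem errGauge_eq_weightedGauge (D : Set Spacetime) (Φ : Spacetime → ℂ)
    (A : Fin 4 → Spacetime → ℝ) (j : Fin 4) :
    errGauge D Φ A j = weightedGauge D ![1, -1, -1, -1] Φ A j := by
  ext x
  simp only [errGauge, weightedGauge, Fin.sum_univ_succ]
  simp
  ring

theorem curv_swap (D : Set Spacetime) (A : Fin 4 → Spacetime → ℝ) (μ ν : Fin 4) :
    curv D A ν μ = fun y => (-1 : ℝ) * curv D A μ ν y := by
  ext y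
  simp only [curv]
  ring

theorem pairing_self (φ : ℂ) : pairing φ φ = ‖φ‖ ^ 2 := by
  rw [pairing, Complex.mul_conj, Complex.normSq_eq_norm_sq, Complex.ofReal_re]

/-- The two pairings are the real and imaginary parts of conj(φ)χ. The formula is what makes the
mass term |φ|²χ appear in 𝓛. -/
theorem norm_sq_mul_eq (φ χ : ℂ) : ((‖φ‖ ^ 2 : ℝ) : ℂ) * χ
    = φ * (pairing φ χ + Complex.I * pairing (Complex.I * φ) χ) := by
  rw [← Complex.normSq_eq_norm_sq, Complex.normSq_apply]
  apply Complex.ext <;>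
  · simp [pairing]
    ring

variable (hD : RegularDomain D)
include hD

theorem RegularDomain.contDiffOn_weightedGauge (w : Fin 4 → ℝ) {Φ : Spacetime → ℂ}
    {A : Fin 4 → Spacetime → ℝ} (hΦ : ContDiffOn ℝ ∞ Φ D) (hA : ∀ j, ContDiffOn ℝ ∞ (A j) D)
    (j : Fin 4) : ContDiffOn ℝ ∞ (weightedGauge D w Φ A j) D :=
  (ContDiffOn.sum fun μ _ =>
    contDiffOn_const.mul (hD.contDiffOn_pd μ (hD.contDiffOn_curv μ j hA))).sub
    ((contDiffOn_const.mul hΦ).pairing (hD.contDiffOn_covD j (hA j) hΦ))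

/-- After exchanging the two derivatives the summand is antisymmetric in μ and ν, so the sum equals
its own negative. The weights do no harm: they are constants and enter symmetrically. -/
theorem RegularDomain.sum_pd_pd_curv (w : Fin 4 → ℝ) {A : Fin 4 → Spacetime → ℝ}
    (hA : ∀ j, ContDiffOn ℝ ∞ (A j) D) (hx : x ∈ D) :
    ∑ μ, ∑ ν, w μ * (w ν * pd D μ (pd D ν (curv D A ν μ)) x) = 0 := by
  have h (μ ν : Fin 4) : pd D μ (pd D ν (curv D A ν μ)) x
      = -pd D ν (pd D μ (curv D A μ ν)) x := by
    rw [hD.pd_comm μ ν (hD.contDiffOn_curv ν μ hA) hx, curv_swap D A μ ν]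
    have e : Set.EqOn (pd D μ fun y => (-1 : ℝ) * curv D A μ ν y)
        (fun y => (-1 : ℝ) * pd D μ (curv D A μ ν) y) D :=
      fun y hy => hD.pd_const_mul _ _ (hD.contDiffOn_curv μ ν hA) hy
    rw [pd_congr ν e hx,
      hD.pd_const_mul _ _ (hD.contDiffOn_pd μ (hD.contDiffOn_curv μ ν hA)) hx]
    ring
  have hs : ∑ μ, ∑ ν, w μ * (w ν * pd D μ (pd D ν (curv D A ν μ)) x)
      = -∑ μ, ∑ ν, w μ * (w ν * pd D μ (pd D ν (curv D A ν μ)) x) := by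
    conv_rhs => rw [Finset.sum_comm]
    simp only [← Finset.sum_neg_distrib]
    refine Finset.sum_congr rfl fun μ _ => Finset.sum_congr rfl fun ν _ => ?_
    rw [h μ ν]
    ring
  linarith

/-- The pairing obeys the covariant product rule, and the other term (iDΦ, DΦ) vanishes. -/
theorem RegularDomain.pd_current {a : Spacetime → ℝ} {Φ : Spacetime → ℂ}
    (ha : ContDiffOn ℝ ∞ a D) (hΦ : ContDiffOn ℝ ∞ Φ D) (μ : Fin 4) (hx : x ∈ D) :
    pd D μ (fun y => pairing (Complex.I * Φ y) (covD D μ a Φ y)) x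
      = pairing (Complex.I * Φ x) (covD D μ a (covD D μ a Φ) x) := by
  rw [hD.pd_pairing μ (contDiffOn_const.mul hΦ) (hD.contDiffOn_covD μ ha hΦ) hx,
    hD.pd_const_mul _ _ hΦ hx]
  have e : covD D μ a (covD D μ a Φ) x = pd D μ (covD D μ a Φ) x
      - Complex.I * a x * (pd D μ Φ x - Complex.I * a x * Φ x) := rfl
  rw [e]
  simp only [covD]
  simp [pairing]
  ring

/-- The identity between the components of the field equations implied by gauge invariance. -/
theorem RegularDomain.gauge_identity (w : Fin 4 → ℝ) {Φ : Spacetime → ℂ}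
    {A : Fin 4 → Spacetime → ℝ} (hΦ : ContDiffOn ℝ ∞ Φ D) (hA : ∀ j, ContDiffOn ℝ ∞ (A j) D)
    (hx : x ∈ D) :
    pairing (weightedHiggs D w Φ A x) (Complex.I * Φ x)
      + ∑ μ, w μ * pd D μ (weightedGauge D w Φ A μ) x = 0 := by
  have h1 (μ : Fin 4) : pd D μ (weightedGauge D w Φ A μ) x
      = ∑ ν, w ν * pd D μ (pd D ν (curv D A ν μ)) x
        - pairing (Complex.I * Φ x) (covD D μ (A μ) (covD D μ (A μ) Φ) x) := by
    have hc (ν : Fin 4) := hD.contDiffOn_pd ν (hD.contDiffOn_curv ν μ hA)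
    have hs (ν : Fin 4) : ContDiffOn ℝ ∞ (fun y => w ν * pd D ν (curv D A ν μ) y) D :=
      contDiffOn_const.mul (hc ν)
    unfold weightedGauge
    rw [hD.pd_sub μ (ContDiffOn.sum fun ν _ => hs ν)
      ((contDiffOn_const.mul hΦ).pairing (hD.contDiffOn_covD μ (hA μ) hΦ)) hx,
      hD.pd_sum _ _ (fun ν _ => hs ν) hx, hD.pd_current (hA μ) hΦ μ hx]
    simp only [fun ν => hD.pd_const_mul (w ν) μ (hc ν) hx]
  have h2 := hD.sum_pd_pd_curv w hA hx
  simp only [h1, mul_sub, Finset.sum_sub_distrib, Finset.mul_sum, h2]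
  simp only [weightedHiggs, pairing, add_mul, Finset.sum_mul, Complex.add_re, Complex.re_sum]
  rw [zero_sub, add_right_comm, ← sub_eq_add_neg, ← Finset.sum_sub_distrib,
    Finset.sum_eq_zero fun μ _ => ?_, zero_add]
  -- The potential term is a real multiple of Φ, hence orthogonal to iΦ whatever the multiple is.
  · generalize (1 / 2 : ℝ) * (‖Φ x‖ ^ 2 - 1) = r
    simp
    ring
  · simp
    ring

/-- Vortices solve the static second order Higgs equation. -/
theorem RegularDomain.bogomolny_higgs {φ : Spacetime → ℂ} {a b : Spacetime → ℝ} {i j : Fin 4}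
    (hφ : ContDiffOn ℝ ∞ φ D) (ha : ContDiffOn ℝ ∞ a D) (hb : ContDiffOn ℝ ∞ b D)
    (h1 : ∀ y ∈ D, covD D i a φ y + Complex.I * covD D j b φ y = 0)
    (h2 : ∀ y ∈ D, pd D i b y - pd D j a y + (1 / 2) * (‖φ y‖ ^ 2 - 1) = 0) (hx : x ∈ D) :
    -(covD D i a (covD D i a φ) x + covD D j b (covD D j b φ) x)
      + (((1 / 2 : ℝ) * (‖φ x‖ ^ 2 - 1) : ℝ) : ℂ) * φ x = 0 := by
  have su := hD.contDiffOn_covD i ha hφ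
  have sv := hD.contDiffOn_covD j hb hφ
  -- Derivatives of the first Bogomolny equation. With the commutator they give (D_i - iD_j)(D_i +
  -- iD_j)φ = (D_i² + D_j²)φ + i[D_i, D_j]φ = 0, and the curvature in the commutator is known from
  -- `h2`.
  have d (μ : Fin 4) : pd D μ (covD D i a φ) x + Complex.I * pd D μ (covD D j b φ) x = 0 := by
    rw [← hD.pd_const_mul _ _ sv hx, ← hD.pd_add μ su (contDiffOn_const.mul sv) hx]
    exact pd_eq_zero μ h1 hx
  have c := hD.covD_comm i j ha hb hφ hx
  have e (μ : Fin 4) (a : Spacetime → ℝ) (f : Spacetime → ℂ) :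
    covD D μ a f x = pd D μ f x - Complex.I * a x * f x := rfl
  have h1x := h1 x hx
  have h2x : (((pd D i b x - pd D j a x : ℝ) : ℂ) + (((1 / 2 : ℝ) * (‖φ x‖ ^ 2 - 1) : ℝ) : ℂ)) = 0 := by
    rw [← Complex.ofReal_add, h2 x hx, Complex.ofReal_zero]
  rw [e i a (covD D i a φ), e j b (covD D j b φ)] at *
  rw [e i a (covD D j b φ), e j b (covD D i a φ)] at c
  linear_combination φ x * h2x - d i + Complex.I * d j + Complex.I * c
    + (Complex.I * a x + b x) * h1x - (covD D i a φ x * b x + pd D j (covD D j b φ) x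
      + φ x * ((pd D i b x - pd D j a x : ℝ) : ℂ)) * Complex.I_sq

/-- Since (φ, iaφ) = 0, the real potential `a` is arbitrary here; it can be chosen to match the
direction of the derivative. -/
theorem RegularDomain.pd_norm_sq {a : Spacetime → ℝ} {φ : Spacetime → ℂ}
    (hφ : ContDiffOn ℝ ∞ φ D) (μ : Fin 4) (hx : x ∈ D) :
    pd D μ (fun y => ‖φ y‖ ^ 2) x = 2 * pairing (φ x) (covD D μ a φ x) := by
  have e : (fun y => ‖φ y‖ ^ 2) = fun y => pairing (φ y) (φ y) := by
    ext y
    rw [pairing_self]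
  rw [e, hD.pd_pairing μ hφ hφ hx]
  simp [pairing, covD]
  ring

theorem RegularDomain.pd_bogomolny_curv {φ : Spacetime → ℂ} {c a : Spacetime → ℝ}
    (hφ : ContDiffOn ℝ ∞ φ D) (hc : ContDiffOn ℝ ∞ c D)
    (h2 : ∀ y ∈ D, c y + (1 / 2) * (‖φ y‖ ^ 2 - 1) = 0) (μ : Fin 4) (hx : x ∈ D) :
    pd D μ c x = -pairing (φ x) (covD D μ a φ x) := by
  have hn : ContDiffOn ℝ ∞ (fun y => ‖φ y‖ ^ 2) D := hφ.norm_sq ℝ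
  have hs : ContDiffOn ℝ ∞ (fun y => (1 / 2 : ℝ) * (‖φ y‖ ^ 2 - 1)) D :=
    contDiffOn_const.mul (hn.sub contDiffOn_const)
  have h := hD.pd_add μ hc hs hx
  rw [pd_eq_zero μ h2 hx, hD.pd_const_mul _ _ (hn.sub contDiffOn_const) hx,
    hD.pd_sub μ hn contDiffOn_const hx, pd_const, hD.pd_norm_sq (a := a) hφ μ hx] at h
  linarith

/-- Vortices solve the static second order equation for the gauge field. -/
theorem RegularDomain.bogomolny_gauge {φ : Spacetime → ℂ} {a b : Spacetime → ℝ} {i j : Fin 4}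
    (hφ : ContDiffOn ℝ ∞ φ D) (ha : ContDiffOn ℝ ∞ a D) (hb : ContDiffOn ℝ ∞ b D)
    (h1 : ∀ y ∈ D, covD D i a φ y + Complex.I * covD D j b φ y = 0)
    (h2 : ∀ y ∈ D, pd D i b y - pd D j a y + (1 / 2) * (‖φ y‖ ^ 2 - 1) = 0) (hx : x ∈ D) :
    pd D j (fun y => pd D i b y - pd D j a y) x = pairing (Complex.I * φ x) (covD D i a φ x) ∧
    -pd D i (fun y => pd D i b y - pd D j a y) x
      = pairing (Complex.I * φ x) (covD D j b φ x) := by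
  have hc := (hD.contDiffOn_pd i hb).sub (hD.contDiffOn_pd j ha)
  -- Each derivative of the curvature is written with the covariant derivative in its own direction;
  -- D_iφ = -iD_jφ then exchanges the two directions.
  rw [hD.pd_bogomolny_curv (a := b) hφ hc h2 j hx, hD.pd_bogomolny_curv (a := a) hφ hc h2 i hx,
    eq_neg_of_add_eq_zero_left (h1 x hx)]
  constructor <;>
  · simp [pairing]
    ring

/-- Solutions of the linearized Bogomolny equations in the orthogonal gauge solve the Higgs
component of the linearized static equations. -/
theorem RegularDomain.linearized_higgs {φ χ : Spacetime → ℂ} {a b p q : Spacetime → ℝ}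
    {i j : Fin 4}
    (hφ : ContDiffOn ℝ ∞ φ D) (ha : ContDiffOn ℝ ∞ a D) (hb : ContDiffOn ℝ ∞ b D)
    (hχ : ContDiffOn ℝ ∞ χ D) (hp : ContDiffOn ℝ ∞ p D) (hq : ContDiffOn ℝ ∞ q D)
    (h1 : ∀ y ∈ D, covD D i a φ y + Complex.I * covD D j b φ y = 0)
    (h2 : ∀ y ∈ D, pd D i b y - pd D j a y + (1 / 2) * (‖φ y‖ ^ 2 - 1) = 0)
    (l1 : ∀ y ∈ D, covD D i a χ y + Complex.I * covD D j b χ y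
      - Complex.I * ((p y : ℂ) + Complex.I * (q y : ℂ)) * φ y = 0)
    (l2 : ∀ y ∈ D, pd D i q y - pd D j p y + pairing (φ y) (χ y) = 0)
    (l3 : ∀ y ∈ D, pd D i p y + pd D j q y - pairing (Complex.I * φ y) (χ y) = 0) (hx : x ∈ D) :
    -(covD D i a (covD D i a χ) x - 2 * Complex.I * (p x : ℂ) * covD D i a φ x
      + (covD D j b (covD D j b χ) x - 2 * Complex.I * (q x : ℂ) * covD D j b φ x))
      + (((1 / 2 : ℝ) * (3 * ‖φ x‖ ^ 2 - 1) : ℝ) : ℂ) * χ x = 0 := by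
  have su := hD.contDiffOn_covD i ha hχ
  have sv := hD.contDiffOn_covD j hb hχ
  have sr : ContDiffOn ℝ ∞ (fun y => (p y : ℂ) + Complex.I * (q y : ℂ)) D :=
    hp.ofReal.add (contDiffOn_const.mul hq.ofReal)
  have sw : ContDiffOn ℝ ∞ (fun y => Complex.I * ((p y : ℂ) + Complex.I * (q y : ℂ))) D :=
    contDiffOn_const.mul sr
  have d (μ : Fin 4) : pd D μ (covD D i a χ) x + Complex.I * pd D μ (covD D j b χ) x
      - (Complex.I * (p x + Complex.I * q x) * pd D μ φ x
        + Complex.I * (pd D μ p x + Complex.I * pd D μ q x) * φ x) = 0 := by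
    rw [← hD.pd_const_mul _ _ sv hx, ← hD.pd_ofReal _ hp hx, ← hD.pd_ofReal _ hq hx,
      ← hD.pd_const_mul _ _ hq.ofReal hx,
      ← hD.pd_add μ hp.ofReal (contDiffOn_const.mul hq.ofReal) hx, ← hD.pd_const_mul _ _ sr hx,
      ← hD.pd_add μ su (contDiffOn_const.mul sv) hx, ← hD.pd_mul μ sw hφ hx,
      ← hD.pd_sub μ (su.add (contDiffOn_const.mul sv)) (sw.mul hφ) hx]
    exact pd_eq_zero μ l1 hx
  have c := hD.covD_comm i j ha hb hχ hx
  have e (μ : Fin 4) (a : Spacetime → ℝ) (f : Spacetime → ℂ) :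
    covD D μ a f x = pd D μ f x - Complex.I * a x * f x := rfl
  have h1x := h1 x hx
  have l1x := l1 x hx
  have h2x := congrArg (fun r : ℝ => (r : ℂ)) (h2 x hx)
  have l2x := congrArg (fun r : ℝ => (r : ℂ)) (l2 x hx)
  have l3x := congrArg (fun r : ℝ => (r : ℂ)) (l3 x hx)
  -- Acting with D_i - iD_j on i(p + iq)φ produces the divergence and the curl of (p, q). By `l3`
  -- and `l2` these are (iφ, χ) and -(φ, χ), which reassemble to |φ|²χ.
  have n := norm_sq_mul_eq (φ x) (χ x)
  rw [e i a (covD D i a χ), e j b (covD D j b χ)] at *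
  rw [e i a (covD D j b χ), e j b (covD D i a χ)] at c
  have fi := e i a φ
  have fj := e j b φ
  push_cast at *
  linear_combination (-d i) + Complex.I * d j + Complex.I * c
    + (Complex.I * a x + b x) * l1x + n + χ x * h2x + φ x * l2x - Complex.I * φ x * l3x
    + (Complex.I * p x - q x) * fi + (Complex.I * q x + p x) * fj + (Complex.I * p x + q x) * h1x
    + (-(covD D i a χ x * b x + pd D j (covD D j b χ) x
      + χ x * (((pd D i b x : ℝ) : ℂ) - ((pd D j a x : ℝ) : ℂ))
      + ((pd D i q x : ℝ) : ℂ) * φ x - ((pd D j p x : ℝ) : ℂ) * φ x) + Complex.I * φ x * ((pd D j q x : ℝ) : ℂ)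
      + Complex.I * q x * pd D j φ x - q x * pd D i φ x + Complex.I * a x * q x * φ x
      + p x * pd D j φ x - p x * covD D j b φ x) * Complex.I_sq

/-- The planar vector Laplacian is built from the gradients of the divergence and of the curl, which
`l3` and `l2` express through pairings of φ and χ. After differentiation, the first order equations
for φ and χ exchange the directions i and j inside these pairings. -/
theorem RegularDomain.linearized_gauge {φ χ : Spacetime → ℂ} {a b p q : Spacetime → ℝ}
    {i j : Fin 4}
    (hφ : ContDiffOn ℝ ∞ φ D)
    (hχ : ContDiffOn ℝ ∞ χ D) (hp : ContDiffOn ℝ ∞ p D) (hq : ContDiffOn ℝ ∞ q D)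
    (h1 : ∀ y ∈ D, covD D i a φ y + Complex.I * covD D j b φ y = 0)
    (l1 : ∀ y ∈ D, covD D i a χ y + Complex.I * covD D j b χ y
      - Complex.I * ((p y : ℂ) + Complex.I * (q y : ℂ)) * φ y = 0)
    (l2 : ∀ y ∈ D, pd D i q y - pd D j p y + pairing (φ y) (χ y) = 0)
    (l3 : ∀ y ∈ D, pd D i p y + pd D j q y - pairing (Complex.I * φ y) (χ y) = 0) (hx : x ∈ D) :
    -(pd D i (pd D i p) x + pd D j (pd D j p) x) + ‖φ x‖ ^ 2 * p x
      - 2 * pairing (Complex.I * χ x) (covD D i a φ x) = 0 ∧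
    -(pd D i (pd D i q) x + pd D j (pd D j q) x) + ‖φ x‖ ^ 2 * q x
      - 2 * pairing (Complex.I * χ x) (covD D j b φ x) = 0 := by
  have pp (μ : Fin 4) {f : Spacetime → ℝ} (hf : ContDiffOn ℝ ∞ f D) := hD.contDiffOn_pd μ hf
  have sφ : ContDiffOn ℝ ∞ (fun y => Complex.I * φ y) D := contDiffOn_const.mul hφ
  have d2 (μ : Fin 4) : pd D μ (pd D i q) x - pd D μ (pd D j p) x
      + (pairing (pd D μ φ x) (χ x) + pairing (φ x) (pd D μ χ x)) = 0 := by
    rw [← hD.pd_pairing μ hφ hχ hx, ← hD.pd_sub μ (pp i hq) (pp j hp) hx,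
      ← hD.pd_add μ ((pp i hq).sub (pp j hp)) (hφ.pairing hχ) hx]
    exact pd_eq_zero μ l2 hx
  have d3 (μ : Fin 4) : pd D μ (pd D i p) x + pd D μ (pd D j q) x
      - (pairing (Complex.I * pd D μ φ x) (χ x) + pairing (Complex.I * φ x) (pd D μ χ x)) = 0 := by
    rw [← hD.pd_const_mul _ _ hφ hx, ← hD.pd_pairing μ sφ hχ hx, ← hD.pd_add μ (pp i hp) (pp j hq) hx,
      ← hD.pd_sub μ ((pp i hp).add (pp j hq)) (sφ.pairing hχ) hx]
    exact pd_eq_zero μ l3 hx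
  have cp := hD.pd_comm i j hp hx
  have cq := hD.pd_comm i j hq hx
  have h1x := h1 x hx
  have l1x := l1 x hx
  have d2i := d2 i
  have d2j := d2 j
  have d3i := d3 i
  have d3j := d3 j
  have nq : ‖φ x‖ ^ 2 = (φ x).re ^ 2 + (φ x).im ^ 2 := by
    rw [← Complex.normSq_eq_norm_sq, Complex.normSq_apply]; ring
  simp only [covD] at h1x l1x
  have h1r := congrArg Complex.re h1x
  have h1i := congrArg Complex.im h1x
  have l1r := congrArg Complex.re l1x
  have l1i := congrArg Complex.im l1x
  simp [pairing] at h1r h1i l1r l1i d2i d2j d3i d3j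
  constructor
  · simp [pairing, covD]
    linear_combination (-1 : ℝ) * d3i + d2j + cq + p x * nq + (χ x).im * h1r - (χ x).re * h1i
      + (φ x).im * l1r - (φ x).re * l1i
  · simp [pairing, covD]
    linear_combination (-1 : ℝ) * d3j - d2i - cp + q x * nq + (χ x).im * h1i + (χ x).re * h1r
      + (φ x).im * l1i + (φ x).re * l1r

end Identities

/-! ### From conditions on planar slices to pointwise equations on the slab. -/

section Slices

variable {E : Type*} [NormedAddCommGroup E] [NormedSpace ℝ E] {T τ ζ : ℝ}

theorem slice_mem_slab (hτ : τ ∈ Set.Icc 0 T) (y : Plane) : ![τ, y 0, y 1, ζ] ∈ slab T := hτ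

theorem hasFDerivAt_slicePoint (τ ζ : ℝ) (y : Plane) :
    HasFDerivAt (fun y : Plane => (![τ, y 0, y 1, ζ] : Spacetime))
      (ContinuousLinearMap.pi ![0, ContinuousLinearMap.proj 0, ContinuousLinearMap.proj 1, 0] :
        Plane →L[ℝ] Spacetime) y := by
  rw [hasFDerivAt_pi]
  intro i
  fin_cases i
  · exact hasFDerivAt_const _ _
  · exact hasFDerivAt_apply (𝕜 := ℝ) (F' := fun _ : Fin 2 => ℝ) 0 y
  · exact hasFDerivAt_apply (𝕜 := ℝ) (F' := fun _ : Fin 2 => ℝ) 1 y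
  · exact hasFDerivAt_const _ _

/-- Chain rule along y ↦ (τ, y, ζ), a map that stays inside the slab even for τ = 0 and τ = T. It
allows the slice conditions to be differentiated in the slow directions too. -/
theorem pd2_slice {f : Spacetime → E} (hf : ContDiffOn ℝ ∞ f (slab T)) (hτ : τ ∈ Set.Icc 0 T)
    (j : Fin 2) : pd2 j (slice f τ ζ) = slice (pd (slab T) (planeIdx j) f) τ ζ := by
  ext y
  have h := (hf.differentiableWithinAt_infty (slice_mem_slab (ζ := ζ) hτ y)).hasFDerivWithinAt
    |>.comp_hasFDerivAt y (hasFDerivAt_slicePoint τ ζ y)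
      (Filter.Eventually.of_forall fun y => slice_mem_slab (ζ := ζ) hτ y)
  simp only [pd2, slice, pd]
  erw [h.fderiv]
  simp only [ContinuousLinearMap.comp_apply]
  congr 1
  ext i
  fin_cases j <;> fin_cases i <;> simp [planeIdx]

theorem covD2_slice {a : Spacetime → ℝ} {f : Spacetime → ℂ} (hf : ContDiffOn ℝ ∞ f (slab T))
    (hτ : τ ∈ Set.Icc 0 T) (α : Fin 2 → Plane → ℝ) (j : Fin 2) (h : α j = slice a τ ζ) :
    covD2 α j (slice f τ ζ) = slice (covD (slab T) (planeIdx j) a f) τ ζ := by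
  ext y
  simp only [covD2, pd2_slice hf hτ, h]
  rfl

omit [NormedAddCommGroup E] [NormedSpace ℝ E] in
theorem slice_self {p : Spacetime} (f : Spacetime → E) :
    slice f (p 0) (p 3) (planePart p) = f p := by
  simp only [slice, planePart]
  congr 1
  ext i
  fin_cases i <;> rfl

theorem gaugeDefect_slice {φ χ : Spacetime → ℂ} {a : Fin 2 → Spacetime → ℝ}
    (ha : ∀ k, ContDiffOn ℝ ∞ (a k) (slab T)) (hτ : τ ∈ Set.Icc 0 T) :
    gaugeDefect (slice φ τ ζ) (slice χ τ ζ) (fun k => slice (a k) τ ζ)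
      = slice (fun p => pd (slab T) 1 (a 0) p + pd (slab T) 2 (a 1) p
        - pairing (Complex.I * φ p) (χ p)) τ ζ := by
  ext y
  simp only [gaugeDefect, pd2_slice (ha _) hτ, Fin.sum_univ_two]
  rfl

theorem gaugeOrthogonal_slice_iff {φ χ : Spacetime → ℂ} {a : Fin 2 → Spacetime → ℝ}
    (ha : ∀ k, ContDiffOn ℝ ∞ (a k) (slab T)) :
    (∀ τ ∈ Set.Icc 0 T, ∀ ζ, GaugeOrthogonal (slice φ τ ζ) (slice χ τ ζ)
      (fun k => slice (a k) τ ζ)) ↔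
    ∀ p ∈ slab T, pd (slab T) 1 (a 0) p + pd (slab T) 2 (a 1) p
      - pairing (Complex.I * φ p) (χ p) = 0 := by
  constructor
  · intro h p hp
    have := h (p 0) hp (p 3) (planePart p)
    rwa [gaugeDefect_slice ha hp, slice_self] at this
  · intro h τ hτ ζ y
    rw [gaugeDefect_slice ha hτ]
    exact h _ (slice_mem_slab hτ y)

theorem IsVortexLift.bogomolny {N : ℕ} {q : ℝ × ℝ → Fin N → ℂ} {φ : Spacetime → ℂ}
    {α : Fin 2 → Spacetime → ℝ} (h : IsVortexLift T q φ α) :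
    (∀ p ∈ slab T, covD (slab T) 1 (α 0) φ p + Complex.I * covD (slab T) 2 (α 1) φ p = 0) ∧
    ∀ p ∈ slab T, pd (slab T) 1 (α 1) p - pd (slab T) 2 (α 0) p
      + (1 / 2) * (‖φ p‖ ^ 2 - 1) = 0 := by
  refine ⟨fun p hp => ?_, fun p hp => ?_⟩
  · have := (h.represents (p 0) hp (p 3)).1.bogomolny_higgs (planePart p)
    rwa [covD2_slice h.smooth_higgs hp _ 0 rfl, covD2_slice h.smooth_higgs hp _ 1 rfl,
      slice_self, slice_self] at this
  · have := (h.represents (p 0) hp (p 3)).1.bogomolny_gauge (planePart p)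
    rwa [curv2, pd2_slice (h.smooth_gauge 1) hp, pd2_slice (h.smooth_gauge 0) hp,
      slice_self, slice_self, slice_self] at this

end Slices

/-! ### Orthogonality of the error vector T. -/

section ErrorVector

variable {T : ℝ} {N : ℕ} {q : ℝ × ℝ → Fin N → ℂ} {φ : Spacetime → ℂ} {α : Fin 2 → Spacetime → ℝ}

theorem RegularDomain.pd_curv {D : Set Spacetime} (hD : RegularDomain D)
    {A : Fin 4 → Spacetime → ℝ} (hA : ∀ j, ContDiffOn ℝ ∞ (A j) D) (κ μ ν : Fin 4)
    {x : Spacetime} (hx : x ∈ D) :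
    pd D κ (curv D A μ ν) x = pd D κ (pd D μ (A ν)) x - pd D κ (pd D ν (A μ)) x :=
  hD.pd_sub κ (hD.contDiffOn_pd μ (hA ν)) (hD.contDiffOn_pd ν (hA μ)) hx

/-- Along a family of vortices the error vector `T` satisfies the gauge orthogonality condition. -/
theorem gaugeOrthogonal_errorT (hT : 0 < T) (h : IsVortexLift T q φ α) {a₀ a₃ : Spacetime → ℝ}
    (h₀ : IsTemporalPotential T φ α 0 a₀) (h₃ : IsTemporalPotential T φ α 3 a₃) :
    ∀ τ ∈ Set.Icc 0 T, ∀ ζ : ℝ,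
      GaugeOrthogonal (slice φ τ ζ) (slice (errorTHiggs T φ a₀ a₃) τ ζ)
        (fun j => slice (errorTGauge T α a₀ a₃ j) τ ζ) := by
  have hD := regularDomain_slab hT
  obtain ⟨B1, B2⟩ := h.bogomolny
  have hα := h.smooth_gauge
  have hφ := h.smooth_higgs
  obtain ⟨ha₀, g₀⟩ := h₀
  obtain ⟨ha₃, g₃⟩ := h₃
  set D := slab T with hDdef
  -- The functions ã₀ and ã₃ complete α to a full potential on the slab of slow variables; ε plays
  -- no role here.
  have hA : ∀ j, ContDiffOn ℝ ∞ ((![a₀, α 0, α 1, a₃] : Fin 4 → Spacetime → ℝ) j) D := by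
    intro j
    fin_cases j
    exacts [ha₀, hα 0, hα 1, ha₃]
  set A : Fin 4 → Spacetime → ℝ := ![a₀, α 0, α 1, a₃] with hAdef
  have pp (μ : Fin 4) {f : Spacetime → ℝ} (hf : ContDiffOn ℝ ∞ f D) := hD.contDiffOn_pd μ hf
  -- Orthogonality of the velocity in the form of Gauss's law: the sum over k of ∂_kF_{jk} equals
  -- the current (iφ, D̃_jφ).
  have o (j : Fin 4) {a : Spacetime → ℝ} (ha : ContDiffOn ℝ ∞ a D)
      (g : ∀ τ ∈ Set.Icc 0 T, ∀ ζ : ℝ,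
        GaugeOrthogonal (slice φ τ ζ) (slice (covD D j a φ) τ ζ)
          (fun k => slice (fun p => pd D j (α k) p - pd D (planeIdx k) a p) τ ζ))
      (p) (hp : p ∈ D) :
      pd D 1 (pd D j (α 0)) p - pd D 1 (pd D 1 a) p
        + (pd D 2 (pd D j (α 1)) p - pd D 2 (pd D 2 a) p)
        - pairing (Complex.I * φ p) (covD D j a φ p) = 0 := by
    have := (gaugeOrthogonal_slice_iff fun k => (pp j (hα k)).sub (pp (planeIdx k) ha)).1 g p hp
    rw [hD.pd_sub _ (pp j (hα 0)) (pp _ ha) hp, hD.pd_sub _ (pp j (hα 1)) (pp _ ha) hp] at this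
    exact this
  have o₀ := o 0 ha₀ g₀
  have o₃ := o 3 ha₃ g₃
  have eT (j : Fin 2) : ∀ p ∈ D, errorTGauge T α a₀ a₃ j p
      = pd D 0 (pd D 0 (α j)) p - pd D 3 (pd D 3 (α j)) p
        - (pd D (planeIdx j) (pd D 0 a₀) p - pd D (planeIdx j) (pd D 3 a₃) p) := by
    intro p hp
    rw [← hD.pd_sub _ (pp 0 ha₀) (pp 3 ha₃) hp]
    rfl
  have hTs (j : Fin 2) : ContDiffOn ℝ ∞ (errorTGauge T α a₀ a₃ j) D :=
    ((pp 0 (pp 0 (hα j))).sub (pp 3 (pp 3 (hα j)))).sub (pp _ ((pp 0 ha₀).sub (pp 3 ha₃)))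
  rw [gaugeOrthogonal_slice_iff hTs]
  intro p hp
  have key := hD.gauge_identity ![1, -1, -1, -1] hφ hA hp
  have w (j : Fin 4) (p) (hp : p ∈ D) : weightedGauge D ![1, -1, -1, -1] φ A j p
      = pd D 0 (pd D 0 (A j)) p - pd D 0 (pd D j a₀) p
        - (pd D 1 (pd D 1 (A j)) p - pd D 1 (pd D j (α 0)) p)
        - (pd D 2 (pd D 2 (A j)) p - pd D 2 (pd D j (α 1)) p)
        - (pd D 3 (pd D 3 (A j)) p - pd D 3 (pd D j a₃) p)
        - pairing (Complex.I * φ p) (covD D j (A j) φ p) := by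
    simp only [weightedGauge, Fin.sum_univ_four, hD.pd_curv hA _ _ _ hp]
    simp [hAdef]
    ring
  -- Gauss's law cancels the planar derivatives of the curvature against the current; only the mixed
  -- curvature F₀₃ remains.
  have w0 : Set.EqOn (weightedGauge D ![1, -1, -1, -1] φ A 0) (fun p => pd D 3 (curv D A 0 3) p) D := by
    intro p hp
    have := o₀ p hp
    rw [w 0 p hp]
    simp only [hD.pd_curv hA _ _ _ hp]
    simp [hAdef] at *
    linarith
  have w3 : Set.EqOn (weightedGauge D ![1, -1, -1, -1] φ A 3) (fun p => pd D 0 (curv D A 0 3) p) D := by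
    intro p hp
    have := o₃ p hp
    rw [w 3 p hp]
    simp only [hD.pd_curv hA _ _ _ hp]
    simp [hAdef] at *
    linarith
  have s (p) (hp : p ∈ D) := hD.bogomolny_gauge hφ (hα 0) (hα 1) B1 B2 hp
  have s' (p) (hp : p ∈ D) (μ : Fin 4) := hD.pd_sub μ (pp 1 (hα 1)) (pp 2 (hα 0)) hp
  -- The static vortex equation removes the planar curvature and the current, and the derivatives in
  -- the slow directions form T.
  have w1 : Set.EqOn (weightedGauge D ![1, -1, -1, -1] φ A 1) (errorTGauge T α a₀ a₃ 0) D := by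
    intro p hp
    have := (s p hp).1
    rw [s' p hp] at this
    rw [w 1 p hp, eT 0 p hp, hD.pd_comm 0 1 ha₀ hp, hD.pd_comm 3 1 ha₃ hp]
    simp [hAdef, planeIdx] at *
    linarith
  have w2 : Set.EqOn (weightedGauge D ![1, -1, -1, -1] φ A 2) (errorTGauge T α a₀ a₃ 1) D := by
    intro p hp
    have := (s p hp).2
    rw [s' p hp] at this
    rw [w 2 p hp, eT 1 p hp, hD.pd_comm 0 2 ha₀ hp, hD.pd_comm 3 2 ha₃ hp]
    simp [hAdef, planeIdx] at *
    linarith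
  have wh : weightedHiggs D ![1, -1, -1, -1] φ A p = errorTHiggs T φ a₀ a₃ p := by
    have := hD.bogomolny_higgs hφ (hα 0) (hα 1) B1 B2 hp
    simp [weightedHiggs, errorTHiggs, Fin.sum_univ_four, hAdef, ← hDdef] at *
    linear_combination this
  -- With the opposite weights of the directions 0 and 3 the mixed derivatives of F₀₃ cancel by
  -- symmetry.
  rw [wh, Fin.sum_univ_four, pd_congr 0 w0 hp, pd_congr 1 w1 hp, pd_congr 2 w2 hp,
    pd_congr 3 w3 hp, hD.pd_comm 0 3 (hD.contDiffOn_curv 0 3 hA) hp] at key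
  have hp' : pairing (Complex.I * φ p) (errorTHiggs T φ a₀ a₃ p)
      = pairing (errorTHiggs T φ a₀ a₃ p) (Complex.I * φ p) := by
    simp [pairing]
    ring
  rw [hp']
  simp at key
  linarith

end ErrorVector

/-! ### Polynomial families in a parameter s with smooth coefficients. -/

section Polynomial

variable {E F : Type*} [NormedAddCommGroup E] [NormedSpace ℝ E]
  [NormedAddCommGroup F] [NormedSpace ℝ F]

/-- Families `G s` of functions that are on `D` polynomials in `s`, with smooth coefficients, in
which only powers `s ^ i` with `lo ≤ i ≤ hi` occur. -/
inductive IsSmoothPoly (D : Set Spacetime) (lo : ℕ) (hi : ℕ∞) : (ℝ → Spacetime → E) → Prop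
  | zero : IsSmoothPoly D lo hi (fun _ _ => 0)
  | monomial (i : ℕ) (g : Spacetime → E) (hlo : lo ≤ i) (hhi : (i : ℕ∞) ≤ hi)
      (hg : ContDiffOn ℝ ∞ g D) : IsSmoothPoly D lo hi (fun s p => s ^ i • g p)
  | add {G H : ℝ → Spacetime → E} (hG : IsSmoothPoly D lo hi G) (hH : IsSmoothPoly D lo hi H) :
      IsSmoothPoly D lo hi (fun s p => G s p + H s p)
  | congr {G H : ℝ → Spacetime → E} (hG : IsSmoothPoly D lo hi G)
      (h : ∀ s, ∀ p ∈ D, H s p = G s p) : IsSmoothPoly D lo hi H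

namespace IsSmoothPoly

variable {D : Set Spacetime} {lo lo' k : ℕ} {hi hi' : ℕ∞} {G H : ℝ → Spacetime → E}

theorem mono (hG : IsSmoothPoly D lo hi G) (h : lo' ≤ lo) (h' : hi ≤ hi') :
    IsSmoothPoly D lo' hi' G := by
  induction hG with
  | zero => exact zero
  | monomial i g hlo hhi hg => exact monomial i g (h.trans hlo) (hhi.trans h') hg
  | add _ _ ih ih' => exact ih.add ih'
  | congr _ h ih => exact ih.congr h

theorem const {g : Spacetime → E} (hg : ContDiffOn ℝ ∞ g D) :
    IsSmoothPoly D 0 hi (fun _ => g) :=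
  (monomial 0 g le_rfl (by simp) hg).congr fun s p _ => by simp

theorem pow_smul (k : ℕ) (hG : IsSmoothPoly D lo hi G) :
    IsSmoothPoly D (lo + k) (hi + k) (fun s p => s ^ k • G s p) := by
  induction hG with
  | zero => exact zero.congr fun s p _ => by simp
  | monomial i g hlo hhi hg =>
    exact (monomial (i + k) g (by omega) (by push_cast; gcongr) hg).congr fun s p _ => by
      rw [smul_smul, pow_add, mul_comm]
  | add _ _ ih ih' => exact (ih.add ih').congr fun s p _ => by simp
  | congr _ h ih => exact ih.congr fun s p hp => by simp only [h s p hp]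

theorem clm (L : E →L[ℝ] F) (hG : IsSmoothPoly D lo hi G) :
    IsSmoothPoly D lo hi (fun s p => L (G s p)) := by
  induction hG with
  | zero => exact zero.congr fun s p _ => by simp
  | monomial i g hlo hhi hg =>
    exact (monomial i (fun p => L (g p)) hlo hhi (L.contDiff.comp_contDiffOn hg)).congr
      fun s p _ => by simp
  | add _ _ ih ih' => exact (ih.add ih').congr fun s p _ => by simp
  | congr _ h ih => exact ih.congr fun s p hp => by rw [h s p hp]

theorem neg (hG : IsSmoothPoly D lo hi G) : IsSmoothPoly D lo hi (fun s p => -G s p) :=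
  hG.clm (-ContinuousLinearMap.id ℝ E)

theorem sub (hG : IsSmoothPoly D lo hi G) (hH : IsSmoothPoly D lo hi H) :
    IsSmoothPoly D lo hi (fun s p => G s p - H s p) :=
  (hG.add hH.neg).congr fun _ _ _ => sub_eq_add_neg _ _

theorem sum {ι : Type*} (t : Finset ι) {G : ι → ℝ → Spacetime → E}
    (hG : ∀ i ∈ t, IsSmoothPoly D lo hi (G i)) :
    IsSmoothPoly D lo hi (fun s p => ∑ i ∈ t, G i s p) := by
  classical
  induction t using Finset.induction_on with
  | empty => exact zero
  | insert a t ha ih =>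
    simp only [Finset.sum_insert ha]
    exact (hG a (by simp)).add (ih fun i hi => hG i (by simp [hi]))

theorem mul {𝔸 : Type*} [NormedCommRing 𝔸] [NormedAlgebra ℝ 𝔸] {G H : ℝ → Spacetime → 𝔸}
    (hG : IsSmoothPoly D lo hi G) (hH : IsSmoothPoly D lo' hi' H) :
    IsSmoothPoly D (lo + lo') (hi + hi') (fun s p => G s p * H s p) := by
  induction hG with
  | zero => exact zero.congr fun s p _ => by simp
  | monomial i g hlo hhi hg =>
    induction hH with
    | zero => exact zero.congr fun s p _ => by simp
    | monomial j h hlo' hhi' hh =>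
      exact (monomial (i + j) (fun p => g p * h p) (by omega) (by push_cast; gcongr)
        (hg.mul hh)).congr fun s p _ => by rw [smul_mul_smul_comm, pow_add]
    | add _ _ ih ih' => exact (ih.add ih').congr fun s p _ => by ring
    | congr _ h ih => exact ih.congr fun s p hp => by rw [h s p hp]
  | add _ _ ih ih' => exact (ih.add ih').congr fun s p _ => by ring
  | congr _ h ih => exact ih.congr fun s p hp => by rw [h s p hp]

theorem contDiffOn (hG : IsSmoothPoly D lo hi G) (s : ℝ) : ContDiffOn ℝ ∞ (G s) D := by
  induction hG with
  | zero => exact contDiffOn_const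
  | monomial i g _ _ hg => exact hg.const_smul _
  | add _ _ ih ih' => exact ih.add ih'
  | congr _ h ih => exact ih.congr (h s)

protected theorem pd (hD : RegularDomain D) (μ : Fin 4) (hG : IsSmoothPoly D lo hi G) :
    IsSmoothPoly D lo hi (fun s => pd D μ (G s)) := by
  induction hG with
  | zero => exact zero.congr fun s p hp => pd_const μ _
  | monomial i g hlo hhi hg =>
    exact (monomial i _ hlo hhi (hD.contDiffOn_pd μ hg)).congr
      fun s p hp => hD.pd_smul _ _ hg hp
  | add h h' ih ih' =>
    exact (ih.add ih').congr fun s p hp => hD.pd_add μ (h.contDiffOn s) (h'.contDiffOn s) hp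
  | congr _ h ih => exact ih.congr fun s p hp => pd_congr μ (h s) hp

/-- The expansion is valid at every length `N ≥ n`, so that two expansions can be compared over a
common range. -/
theorem exists_coeff (hG : IsSmoothPoly D lo hi G) :
    ∃ (n : ℕ) (g : ℕ → Spacetime → E), (∀ i, ContDiffOn ℝ ∞ (g i) D) ∧
      (∀ i p, ¬(lo ≤ i ∧ (i : ℕ∞) ≤ hi) → g i p = 0) ∧
      ∀ N ≥ n, ∀ s, ∀ p ∈ D, G s p = ∑ i ∈ Finset.range N, s ^ i • g i p := by
  induction hG with
  | zero => exact ⟨0, fun _ _ => 0, fun _ => contDiffOn_const, fun _ _ _ => rfl, by simp⟩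
  | monomial i g hlo hhi hg =>
    refine ⟨i + 1, fun j p => if j = i then g p else 0, fun j => ?_, fun j p hj => ?_,
      fun N hN s p _ => ?_⟩
    · by_cases h : j = i <;> simp [h, hg, contDiffOn_const]
    · beta_reduce
      rw [if_neg]
      rintro rfl
      exact hj ⟨hlo, hhi⟩
    · rw [Finset.sum_eq_single i] <;> simp +contextual
      omega
  | add _ _ ih ih' =>
    obtain ⟨n, g, hg, hz, h⟩ := ih
    obtain ⟨n', g', hg', hz', h'⟩ := ih'
    refine ⟨max n n', fun i p => g i p + g' i p, fun i => (hg i).add (hg' i),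
      fun i p hi => by simp [hz i p hi, hz' i p hi], fun N hN s p hp => ?_⟩
    beta_reduce
    rw [h N (le_of_max_le_left hN) s p hp, h' N (le_of_max_le_right hN) s p hp]
    simp [Finset.sum_add_distrib]
  | congr _ h ih =>
    obtain ⟨n, g, hg, hz, h'⟩ := ih
    exact ⟨n, g, hg, hz, fun N hN s p hp => (h s p hp).trans (h' N hN s p hp)⟩

theorem of_coeff {N : ℕ} {g : ℕ → Spacetime → E} (hg : ∀ i, ContDiffOn ℝ ∞ (g i) D)
    (hz : ∀ i < N, ¬(lo ≤ i ∧ (i : ℕ∞) ≤ hi) → ∀ p ∈ D, g i p = 0)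
    (h : ∀ s, ∀ p ∈ D, G s p = ∑ i ∈ Finset.range N, s ^ i • g i p) :
    IsSmoothPoly D lo hi G := by
  refine (sum (Finset.range N) (G := fun i s p => s ^ i • g i p) fun i hi' => ?_).congr h
  by_cases hi : lo ≤ i ∧ (i : ℕ∞) ≤ hi
  · exact monomial i _ hi.1 hi.2 (hg i)
  · exact zero.congr fun s p hp => by simp [hz i (Finset.mem_range.1 hi') hi p hp]

end IsSmoothPoly

/-- A continuous linear functional turns the sum into a real polynomial with infinitely many roots,
and functionals separate points. -/
theorem eq_zero_of_sum_pow_smul {δ : ℝ} (hδ : 0 < δ) {N : ℕ} {c : ℕ → E}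
    (h : ∀ s ∈ Set.Ioo 0 δ, ∑ i ∈ Finset.range N, s ^ i • c i = 0) {i : ℕ} (hi : i < N) :
    c i = 0 := by
  rw [SeparatingDual.eq_zero_iff_forall_dual_eq_zero (R := ℝ)]
  intro L
  let P : Polynomial ℝ := ∑ j ∈ Finset.range N, Polynomial.monomial j (L (c j))
  have hP : P = 0 := by
    refine P.eq_zero_of_infinite_isRoot ((Set.Ioo_infinite hδ).mono fun s hs => ?_)
    have := congrArg L (h s hs)
    simp only [map_sum, map_smul, smul_eq_mul, map_zero] at this
    simp only [P, Set.mem_ofPred_eq, Polynomial.IsRoot, Polynomial.eval_finsetSum,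
      Polynomial.eval_monomial, ← this]
    exact Finset.sum_congr rfl fun j _ => mul_comm _ _
  have := congrArg (fun P : Polynomial ℝ => P.coeff i) hP
  simpa [P, Polynomial.finsetSum_coeff, Polynomial.coeff_monomial, hi] using this

namespace IsSmoothPoly

variable {D : Set Spacetime} {lo lo' k : ℕ} {hi hi' : ℕ∞} {G H : ℝ → Spacetime → E}

/-- The `f i` carry no regularity and the expansion is known only for small positive s. Uniqueness
of coefficients forces the smooth coefficients below order `n` to vanish, so the order holds for all
s. -/
theorem of_expansion {δ : ℝ} (hδ : 0 < δ) (hG : IsSmoothPoly D lo' hi' G) {n m : ℕ}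
    {f : ℕ → Spacetime → E}
    (h : ∀ s ∈ Set.Ioo 0 δ, ∀ p ∈ D, G s p = ∑ i ∈ Finset.Icc n m, s ^ i • f i p) :
    IsSmoothPoly D n ⊤ G := by
  obtain ⟨N, g, hg, -, hs⟩ := hG.exists_coeff
  refine of_coeff hg (fun i hi hni p hp => ?_) (hs (max N (m + 1)) (le_max_left _ _))
  have key := eq_zero_of_sum_pow_smul hδ (N := max N (m + 1))
    (c := fun j => g j p - if j ∈ Finset.Icc n m then f j p else 0) (fun s hs' => ?_) hi
  · simpa [show ¬ n ≤ i by simpa using hni] using key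
  · simp only [smul_sub, Finset.sum_sub_distrib, ← hs _ (le_max_left N (m + 1)) s p hp,
      h s hs' p hp, smul_ite, smul_zero]
    rw [← Finset.sum_filter, sub_eq_zero]
    refine Finset.sum_congr ?_ fun _ _ => rfl
    ext j
    simp
    omega

/-- The order and the degree may be known from different expansions; their coefficients agree by
uniqueness, so both bounds hold for one of them. -/
theorem inter (hG : IsSmoothPoly D lo ⊤ G) (hG' : IsSmoothPoly D 0 hi G) :
    IsSmoothPoly D lo hi G := by
  obtain ⟨n, g, hg, hz, h⟩ := hG.exists_coeff
  obtain ⟨n', g', -, hz', h'⟩ := hG'.exists_coeff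
  refine of_coeff hg (fun i hi hni p hp => ?_) (h (max n n') (le_max_left _ _))
  by_cases hlo : lo ≤ i
  · have key := eq_zero_of_sum_pow_smul one_pos (N := max n n')
      (c := fun j => g j p - g' j p) (fun s _ => ?_) hi
    · rw [hz' i p (by simpa [hlo] using hni), sub_zero] at key
      exact key
    · simp only [smul_sub, Finset.sum_sub_distrib, ← h _ (le_max_left n n') s p hp,
        ← h' _ (le_max_right n n') s p hp, sub_self]
  · exact hz i p (by simp [hlo])

theorem exists_leading (hG : IsSmoothPoly D k hi G) :
    ∃ g : Spacetime → E, ContDiffOn ℝ ∞ g D ∧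
      IsSmoothPoly D (k + 1) hi (fun s p => G s p - s ^ k • g p) := by
  induction hG with
  | zero => exact ⟨fun _ => 0, contDiffOn_const, zero.congr fun s p _ => by simp⟩
  | monomial i g hlo hhi hg =>
    obtain rfl | h := hlo.eq_or_lt
    · exact ⟨g, hg, zero.congr fun s p _ => by simp⟩
    · exact ⟨fun _ => 0, contDiffOn_const, (monomial i g h hhi hg).congr fun s p _ => by simp⟩
  | add _ _ ih ih' =>
    obtain ⟨g, hg, h⟩ := ih
    obtain ⟨g', hg', h'⟩ := ih'
    exact ⟨fun p => g p + g' p, hg.add hg', (h.add h').congr fun s p _ => by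
      simp only [smul_add]
      abel⟩
  | congr _ h ih =>
    obtain ⟨g, hg, h'⟩ := ih
    exact ⟨g, hg, h'.congr fun s p hp => by rw [h s p hp]⟩

theorem eq_zero_of_pow_smul {g : Spacetime → E}
    (h : IsSmoothPoly D (k + 1) hi (fun s p => s ^ k • g p)) {p : Spacetime} (hp : p ∈ D) :
    g p = 0 := by
  obtain ⟨n, f, -, hz, h⟩ := h.exists_coeff
  have key := eq_zero_of_sum_pow_smul one_pos (N := max n (k + 1)) (i := k)
    (c := fun j => f j p - if j = k then g p else 0) (fun s _ => ?_) (by simp)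
  · simpa [hz k p (by simp)] using key
  · simp only [smul_sub, Finset.sum_sub_distrib, ← h _ (le_max_left n (k + 1)) s p hp, smul_ite,
      smul_zero]
    rw [Finset.sum_ite_eq' _ k, if_pos (by simp), sub_self]

theorem exists_expansion {n : ℕ} (hG : IsSmoothPoly D lo n G) :
    ∃ f : ℕ → Spacetime → E, ∀ s, ∀ p ∈ D, G s p = ∑ i ∈ Finset.Icc lo n, s ^ i • f i p := by
  induction hG with
  | zero => exact ⟨fun _ _ => 0, by simp⟩
  | monomial i g hlo hhi hg =>
    refine ⟨fun j p => if j = i then g p else 0, fun s p _ => ?_⟩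
    simp only [smul_ite, smul_zero]
    rw [Finset.sum_ite_eq' _ i, if_pos (Finset.mem_Icc.2 ⟨hlo, by exact_mod_cast hhi⟩)]
  | add _ _ ih ih' =>
    obtain ⟨f, h⟩ := ih
    obtain ⟨f', h'⟩ := ih'
    exact ⟨fun i p => f i p + f' i p, fun s p hp => by
      simp [h s p hp, h' s p hp, Finset.sum_add_distrib]⟩
  | congr _ h ih =>
    obtain ⟨f, h'⟩ := ih
    exact ⟨f, fun s p hp => (h s p hp).trans (h' s p hp)⟩

variable {a : ℝ → Spacetime → ℝ} {f g : ℝ → Spacetime → ℂ}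

theorem ofReal (ha : IsSmoothPoly D lo hi a) :
    IsSmoothPoly D lo hi (fun s p => (a s p : ℂ)) := ha.clm Complex.ofRealCLM

theorem const_mul {𝔸 : Type*} [NormedCommRing 𝔸] [NormedAlgebra ℝ 𝔸] (c : 𝔸)
    {f : ℝ → Spacetime → 𝔸} (hf : IsSmoothPoly D lo hi f) :
    IsSmoothPoly D lo hi (fun s p => c * f s p) := hf.clm (ContinuousLinearMap.mul ℝ 𝔸 c)

protected theorem pairing (hf : IsSmoothPoly D lo hi f) (hg : IsSmoothPoly D lo' hi' g) :
    IsSmoothPoly D (lo + lo') (hi + hi') (fun s p => pairing (f s p) (g s p)) :=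
  (hf.mul (hg.clm (Complex.conjCLE : ℂ →L[ℝ] ℂ))).clm Complex.reCLM

protected theorem covD (hD : RegularDomain D) (μ : Fin 4) (ha : IsSmoothPoly D 0 hi a)
    (hf : IsSmoothPoly D 0 hi' f) :
    IsSmoothPoly D 0 (hi + hi') (fun s => covD D μ (a s) (f s)) :=
  ((hf.pd hD μ).mono le_rfl le_add_self).sub ((ha.ofReal.const_mul Complex.I).mul hf)

protected theorem curv (hD : RegularDomain D) (μ ν : Fin 4) {A : ℝ → Fin 4 → Spacetime → ℝ}
    (hμ : IsSmoothPoly D lo hi (fun s => A s μ)) (hν : IsSmoothPoly D lo hi (fun s => A s ν)) :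
    IsSmoothPoly D lo hi (fun s => curv D (A s) μ ν) :=
  (hν.pd hD μ).sub (hμ.pd hD ν)

end IsSmoothPoly

end Polynomial

/-! ### Calculus of first variations in powers of s. -/

section Variation

variable {E F : Type*} [NormedAddCommGroup E] [NormedSpace ℝ E]
  [NormedAddCommGroup F] [NormedSpace ℝ F]

/-- `G s = G₀ + O(s)` and `G' s = G s + s ^ k • g + O(s ^ (k + 1))`, where the remainders are
polynomial in `s` with smooth coefficients. -/
structure IsVariation (D : Set Spacetime) (k : ℕ) (G G' : ℝ → Spacetime → E)
    (G₀ g : Spacetime → E) : Prop where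
  smooth_base : ContDiffOn ℝ ∞ G₀ D
  smooth_diff : ContDiffOn ℝ ∞ g D
  base : IsSmoothPoly D 1 ⊤ (fun s p => G s p - G₀ p)
  diff : IsSmoothPoly D (k + 1) ⊤ (fun s p => G' s p - G s p - s ^ k • g p)

namespace IsVariation

variable {D : Set Spacetime} {k : ℕ} {G G' H H' : ℝ → Spacetime → E} {G₀ g H₀ h : Spacetime → E}

theorem const (hg : ContDiffOn ℝ ∞ g D) :
    IsVariation D k (fun _ => g) (fun _ => g) g (fun _ => 0) :=
  ⟨hg, contDiffOn_const, IsSmoothPoly.zero.congr fun _ _ _ => by simp,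
    IsSmoothPoly.zero.congr fun _ _ _ => by simp⟩

theorem add (hG : IsVariation D k G G' G₀ g) (hH : IsVariation D k H H' H₀ h) :
    IsVariation D k (fun s p => G s p + H s p) (fun s p => G' s p + H' s p)
      (fun p => G₀ p + H₀ p) (fun p => g p + h p) :=
  ⟨hG.smooth_base.add hH.smooth_base, hG.smooth_diff.add hH.smooth_diff,
    (hG.base.add hH.base).congr fun _ _ _ => by abel,
    (hG.diff.add hH.diff).congr fun _ _ _ => by simp only [smul_add]; abel⟩

theorem clm (L : E →L[ℝ] F) (hG : IsVariation D k G G' G₀ g) :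
    IsVariation D k (fun s p => L (G s p)) (fun s p => L (G' s p))
      (fun p => L (G₀ p)) (fun p => L (g p)) :=
  ⟨L.contDiff.comp_contDiffOn hG.smooth_base, L.contDiff.comp_contDiffOn hG.smooth_diff,
    (hG.base.clm L).congr fun _ _ _ => by simp, (hG.diff.clm L).congr fun _ _ _ => by simp⟩

theorem neg (hG : IsVariation D k G G' G₀ g) :
    IsVariation D k (fun s p => -G s p) (fun s p => -G' s p) (fun p => -G₀ p) (fun p => -g p) :=
  hG.clm (-ContinuousLinearMap.id ℝ E)

theorem sub (hG : IsVariation D k G G' G₀ g) (hH : IsVariation D k H H' H₀ h) :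
    IsVariation D k (fun s p => G s p - H s p) (fun s p => G' s p - H' s p)
      (fun p => G₀ p - H₀ p) (fun p => g p - h p) := by
  simpa only [← sub_eq_add_neg] using hG.add hH.neg

theorem isSmoothPoly (hG : IsVariation D k G G' G₀ g) : IsSmoothPoly D 0 ⊤ G :=
  ((hG.base.mono zero_le_one le_rfl).add (.const hG.smooth_base)).congr fun _ _ _ => by simp

theorem isSmoothPoly_sub (hG : IsVariation D k G G' G₀ g) :
    IsSmoothPoly D k ⊤ (fun s p => G' s p - G s p) :=
  ((hG.diff.mono k.le_succ le_rfl).add (.monomial k g le_rfl le_top hG.smooth_diff)).congr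
    fun _ _ _ => by simp

theorem isSmoothPoly' (hG : IsVariation D k G G' G₀ g) : IsSmoothPoly D 0 ⊤ G' :=
  ((hG.isSmoothPoly_sub.mono k.zero_le le_rfl).add hG.isSmoothPoly).congr fun _ _ _ => by simp

/-- Multiplication by the parameter removes the leading parts. -/
theorem smul_param (hG : IsVariation D k G G' G₀ g) :
    IsVariation D k (fun s p => s • G s p) (fun s p => s • G' s p) (fun _ => 0) (fun _ => 0) :=
  ⟨contDiffOn_const, contDiffOn_const,
    ((hG.isSmoothPoly.pow_smul 1).mono (by simp) le_top).congr fun _ _ _ => by simp,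
    ((hG.isSmoothPoly_sub.pow_smul 1).mono le_rfl le_top).congr fun _ _ _ => by simp [smul_sub]⟩

protected theorem pd (hD : RegularDomain D) (μ : Fin 4) (hG : IsVariation D k G G' G₀ g) :
    IsVariation D k (fun s => pd D μ (G s)) (fun s => pd D μ (G' s)) (pd D μ G₀) (pd D μ g) := by
  refine ⟨hD.contDiffOn_pd μ hG.smooth_base, hD.contDiffOn_pd μ hG.smooth_diff,
    (hG.base.pd hD μ).congr fun s p hp => ?_, (hG.diff.pd hD μ).congr fun s p hp => ?_⟩
  · rw [hD.pd_sub μ (hG.isSmoothPoly.contDiffOn s) hG.smooth_base hp]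
  · rw [hD.pd_sub μ (hG.isSmoothPoly_sub.contDiffOn s) (hG.smooth_diff.const_smul (s ^ k)) hp,
      hD.pd_sub μ (hG.isSmoothPoly'.contDiffOn s) (hG.isSmoothPoly.contDiffOn s) hp,
      hD.pd_smul _ _ hG.smooth_diff hp]

theorem mul {𝔸 : Type*} [NormedCommRing 𝔸] [NormedAlgebra ℝ 𝔸] {G G' H H' : ℝ → Spacetime → 𝔸}
    {G₀ g H₀ h : Spacetime → 𝔸} (hk : 1 ≤ k)
    (hG : IsVariation D k G G' G₀ g) (hH : IsVariation D k H H' H₀ h) :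
    IsVariation D k (fun s p => G s p * H s p) (fun s p => G' s p * H' s p)
      (fun p => G₀ p * H₀ p) (fun p => g p * H₀ p + G₀ p * h p) := by
  refine ⟨hG.smooth_base.mul hH.smooth_base,
    (hG.smooth_diff.mul hH.smooth_base).add (hG.smooth_base.mul hH.smooth_diff), ?_, ?_⟩
  · exact (((hG.base.mul hH.isSmoothPoly).mono le_rfl le_top).add
      (((IsSmoothPoly.const (hi := ⊤) hG.smooth_base).mul hH.base).mono (by simp) le_top)).congr
      fun _ _ _ => by ring
  · have h1 := hG.diff.mul hH.isSmoothPoly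
    have h2 := (IsSmoothPoly.monomial k g le_rfl (hi := ⊤) le_top hG.smooth_diff).mul hH.base
    have h3 := hG.isSmoothPoly.mul hH.diff
    have h4 := hG.base.mul (.monomial k h le_rfl (hi := ⊤) le_top hH.smooth_diff)
    -- The product of the two increments has order 2k, which reaches k + 1 because k ≥ 1.
    have h5 := hG.isSmoothPoly_sub.mul hH.isSmoothPoly_sub
    refine ((((h1.mono ?_ le_top).add (h2.mono le_rfl le_top)).add ((h3.mono ?_ le_top).add
      (h4.mono ?_ le_top))).add (h5.mono ?_ le_top)).congr fun s p _ => ?_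
    any_goals omega
    simp only [Algebra.smul_def]
    ring

theorem congr {K K' : ℝ → Spacetime → E} (hG : IsVariation D k G G' G₀ g)
    (hK : ∀ s, ∀ p ∈ D, K s p = G s p) (hK' : ∀ s, ∀ p ∈ D, K' s p = G' s p)
    (h₀ : ∀ p ∈ D, H₀ p = G₀ p) (h₁ : ∀ p ∈ D, h p = g p) : IsVariation D k K K' H₀ h :=
  ⟨hG.smooth_base.congr h₀, hG.smooth_diff.congr h₁,
    hG.base.congr fun s p hp => by rw [hK s p hp, h₀ p hp],
    hG.diff.congr fun s p hp => by rw [hK s p hp, hK' s p hp, h₁ p hp]⟩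

protected theorem pairing {G G' H H' : ℝ → Spacetime → ℂ} {G₀ g H₀ h : Spacetime → ℂ} (hk : 1 ≤ k)
    (hG : IsVariation D k G G' G₀ g) (hH : IsVariation D k H H' H₀ h) :
    IsVariation D k (fun s p => pairing (G s p) (H s p)) (fun s p => pairing (G' s p) (H' s p))
      (fun p => pairing (G₀ p) (H₀ p)) (fun p => pairing (g p) (H₀ p) + pairing (G₀ p) (h p)) :=
  (hG.mul hk (hH.clm (Complex.conjCLE : ℂ →L[ℝ] ℂ))).clm Complex.reCLM

theorem const_mul {𝔸 : Type*} [NormedCommRing 𝔸] [NormedAlgebra ℝ 𝔸] (c : 𝔸)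
    {G G' : ℝ → Spacetime → 𝔸} {G₀ g : Spacetime → 𝔸} (hG : IsVariation D k G G' G₀ g) :
    IsVariation D k (fun s p => c * G s p) (fun s p => c * G' s p) (fun p => c * G₀ p)
      (fun p => c * g p) :=
  hG.clm (ContinuousLinearMap.mul ℝ 𝔸 c)

theorem ofReal {a a' : ℝ → Spacetime → ℝ} {a₀ b : Spacetime → ℝ}
    (ha : IsVariation D k a a' a₀ b) :
    IsVariation D k (fun s p => (a s p : ℂ)) (fun s p => (a' s p : ℂ)) (fun p => (a₀ p : ℂ))
      (fun p => (b p : ℂ)) :=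
  ha.clm Complex.ofRealCLM

protected theorem covD (hD : RegularDomain D) (hk : 1 ≤ k) (μ : Fin 4) {a a' : ℝ → Spacetime → ℝ}
    {a₀ b : Spacetime → ℝ} (ha : IsVariation D k a a' a₀ b)
    {Φ Φ' : ℝ → Spacetime → ℂ} {φ χ : Spacetime → ℂ} (hΦ : IsVariation D k Φ Φ' φ χ) :
    IsVariation D k (fun s => covD D μ (a s) (Φ s)) (fun s => covD D μ (a' s) (Φ' s))
      (covD D μ a₀ φ) (fun p => covD D μ a₀ χ p - Complex.I * b p * φ p) :=
  ((hΦ.pd hD μ).sub ((ha.ofReal.const_mul Complex.I).mul hk hΦ)).congr (fun _ _ _ => rfl)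
    (fun _ _ _ => rfl) (fun _ _ => rfl) (fun p _ => by simp only [covD]; ring)

protected theorem curv (hD : RegularDomain D) (μ ν : Fin 4) {A A' : ℝ → Fin 4 → Spacetime → ℝ}
    {A₀ B : Fin 4 → Spacetime → ℝ}
    (hA : ∀ j, IsVariation D k (fun s => A s j) (fun s => A' s j) (A₀ j) (B j)) :
    IsVariation D k (fun s => curv D (A s) μ ν) (fun s => curv D (A' s) μ ν)
      (curv D A₀ μ ν) (curv D B μ ν) :=
  ((hA ν).pd hD μ).sub ((hA μ).pd hD ν)

end IsVariation

end Variation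

/-! ### The operator 𝓛 as first variation of the weighted field equations. -/

section Equations

variable {D : Set Spacetime} {k : ℕ}

theorem weightedHiggs_param (s : ℝ) (Φ : Spacetime → ℂ) (A : Fin 4 → Spacetime → ℝ)
    (p : Spacetime) :
    weightedHiggs D ![s, -1, -1, -s] Φ A p
      = s • (covD D 0 (A 0) (covD D 0 (A 0) Φ) p - covD D 3 (A 3) (covD D 3 (A 3) Φ) p)
        - (covD D 1 (A 1) (covD D 1 (A 1) Φ) p + covD D 2 (A 2) (covD D 2 (A 2) Φ) p)
        + (1 / 2 : ℂ) * (((pairing (Φ p) (Φ p) : ℝ) : ℂ) * Φ p - Φ p) := by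
  have e := pairing_self (Φ p)
  simp [weightedHiggs, Fin.sum_univ_four, e]
  ring

theorem weightedGauge_param (s : ℝ) (Φ : Spacetime → ℂ) (A : Fin 4 → Spacetime → ℝ)
    (j : Fin 4) (p : Spacetime) :
    weightedGauge D ![s, -1, -1, -s] Φ A j p
      = s • (pd D 0 (curv D A 0 j) p - pd D 3 (curv D A 3 j) p)
        - (pd D 1 (curv D A 1 j) p + pd D 2 (curv D A 2 j) p)
        - pairing (Complex.I * Φ p) (covD D j (A j) Φ p) := by
  simp [weightedGauge, Fin.sum_univ_four]
  ring

/-- The static linearized operator, Higgs component, in terms of derivatives on `D`. -/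
def linHiggsOn (D : Set Spacetime) (φ : Spacetime → ℂ) (a b : Spacetime → ℝ)
    (χ : Spacetime → ℂ) (p q : Spacetime → ℝ) (x : Spacetime) : ℂ :=
  -(covD D 1 a (covD D 1 a χ) x - 2 * Complex.I * (p x : ℂ) * covD D 1 a φ x
      + (covD D 2 b (covD D 2 b χ) x - 2 * Complex.I * (q x : ℂ) * covD D 2 b φ x))
    + (((1 / 2 : ℝ) * (3 * ‖φ x‖ ^ 2 - 1) : ℝ) : ℂ) * χ x
    + Complex.I * φ x * ((pd D 1 p x + pd D 2 q x - pairing (Complex.I * φ x) (χ x) : ℝ) : ℂ)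

/-- The static linearized operator, gauge component `j`, in terms of derivatives on `D`. -/
def linGaugeOn (D : Set Spacetime) (φ : Spacetime → ℂ) (χ : Spacetime → ℂ)
    (p q : Spacetime → ℝ) (j : Fin 4) (a' p' : Spacetime → ℝ) (x : Spacetime) : ℝ :=
  -(pd D 1 (pd D 1 p') x + pd D 2 (pd D 2 p') x) + ‖φ x‖ ^ 2 * p' x
    - 2 * pairing (Complex.I * χ x) (covD D j a' φ x)
    + pd D j (fun y => pd D 1 p y + pd D 2 q y - pairing (Complex.I * φ y) (χ y)) x

theorem RegularDomain.covD_variation (hD : RegularDomain D) {a b : Spacetime → ℝ}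
    {φ χ : Spacetime → ℂ} (ha : ContDiffOn ℝ ∞ a D) (hb : ContDiffOn ℝ ∞ b D)
    (hφ : ContDiffOn ℝ ∞ φ D) (hχ : ContDiffOn ℝ ∞ χ D) (μ : Fin 4) {p : Spacetime} (hp : p ∈ D) :
    covD D μ a (fun p => covD D μ a χ p - Complex.I * b p * φ p) p
      = covD D μ a (covD D μ a χ) p
        - Complex.I * (pd D μ b p * φ p + b p * covD D μ a φ p) := by
  have h1 : covD D μ a (fun p => covD D μ a χ p - Complex.I * b p * φ p) p
      = pd D μ (fun p => covD D μ a χ p - Complex.I * b p * φ p) p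
        - Complex.I * a p * (covD D μ a χ p - Complex.I * b p * φ p) := rfl
  have h2 : covD D μ a (covD D μ a χ) p
      = pd D μ (covD D μ a χ) p - Complex.I * a p * covD D μ a χ p := rfl
  have h3 : covD D μ a φ p = pd D μ φ p - Complex.I * a p * φ p := rfl
  have hb' := hb.ofReal
  rw [h1, h2, h3, hD.pd_sub μ (hD.contDiffOn_covD μ ha hχ)
    ((contDiffOn_const.mul hb').mul hφ) hp, hD.pd_mul μ (contDiffOn_const.mul hb') hφ hp,
    hD.pd_const_mul _ _ hb' hp, hD.pd_ofReal _ hb hp]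
  ring

variable {Φ Φ' : ℝ → Spacetime → ℂ} {φ χ : Spacetime → ℂ} {A A' : ℝ → Fin 4 → Spacetime → ℝ}
  {A₀ B : Fin 4 → Spacetime → ℝ}

/-- The first variation of the Higgs equation. -/
protected theorem IsVariation.weightedHiggs (hD : RegularDomain D) (hk : 1 ≤ k)
    (hΦ : IsVariation D k Φ Φ' φ χ)
    (hA : ∀ j, IsVariation D k (fun s => A s j) (fun s => A' s j) (A₀ j) (B j)) :
    ∃ G₀, IsVariation D k (fun s => weightedHiggs D ![s, -1, -1, -s] (Φ s) (A s))
      (fun s => weightedHiggs D ![s, -1, -1, -s] (Φ' s) (A' s)) G₀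
      (linHiggsOn D φ (A₀ 1) (A₀ 2) χ (B 1) (B 2)) := by
  have d (μ : Fin 4) := (hA μ).covD hD hk μ ((hA μ).covD hD hk μ hΦ)
  -- The factor s pushes the directions 0 and 3 to higher order, so only the planar part of the
  -- perturbation of the potential enters the variation.
  have h := (((d 0).sub (d 3)).smul_param.sub ((d 1).add (d 2))).add
    ((((hΦ.pairing hk hΦ).ofReal.mul hk hΦ).sub hΦ).const_mul (1 / 2 : ℂ))
  refine ⟨_, h.congr (fun s p _ => weightedHiggs_param ..) (fun s p _ => weightedHiggs_param ..)
    (fun _ _ => rfl) fun p hp => ?_⟩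
  rw [hD.covD_variation (hA 1).smooth_base (hA 1).smooth_diff hΦ.smooth_base hΦ.smooth_diff 1 hp,
    hD.covD_variation (hA 2).smooth_base (hA 2).smooth_diff hΦ.smooth_base hΦ.smooth_diff 2 hp]
  -- It turns (φ, χ)φ into |φ|²χ - iφ(iφ, χ); the last term joins the divergence coming from
  -- `covD_variation` and forms the gauge defect.
  have n := norm_sq_mul_eq (φ p) (χ p)
  have e := pairing_self (φ p)
  have e' : pairing (χ p) (φ p) = pairing (φ p) (χ p) := by simp [pairing]; ring
  simp only [linHiggsOn, e, e']
  push_cast at *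
  linear_combination n

/-- The first variation of the equations for the planar components of the gauge field. -/
protected theorem IsVariation.weightedGauge (hD : RegularDomain D) (hk : 1 ≤ k)
    (hΦ : IsVariation D k Φ Φ' φ χ)
    (hA : ∀ j, IsVariation D k (fun s => A s j) (fun s => A' s j) (A₀ j) (B j)) {j : Fin 4}
    (hj : j = 1 ∨ j = 2) :
    ∃ G₀, IsVariation D k (fun s => weightedGauge D ![s, -1, -1, -s] (Φ s) (A s) j)
      (fun s => weightedGauge D ![s, -1, -1, -s] (Φ' s) (A' s) j) G₀
      (linGaugeOn D φ χ (B 1) (B 2) j (A₀ j) (B j)) := by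
  have d (μ : Fin 4) := (IsVariation.curv hD μ j hA).pd hD μ
  have h := (((d 0).sub (d 3)).smul_param.sub ((d 1).add (d 2))).sub
    ((hΦ.const_mul Complex.I).pairing hk ((hA j).covD hD hk j hΦ))
  refine ⟨_, h.congr (fun s p _ => weightedGauge_param ..) (fun s p _ => weightedGauge_param ..)
    (fun _ _ => rfl) fun p hp => ?_⟩
  have sB := fun j => (hA j).smooth_diff
  have pp (μ ν : Fin 4) := hD.contDiffOn_pd μ (sB ν)
  have sφ : ContDiffOn ℝ ∞ (fun y => Complex.I * φ y) D := contDiffOn_const.mul hΦ.smooth_base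
  simp only [linGaugeOn, hD.pd_curv sB _ _ _ hp]
  rw [hD.pd_sub j ((pp 1 1).add (pp 2 2)) (sφ.pairing hΦ.smooth_diff) hp,
    hD.pd_add j (pp 1 1) (pp 2 2) hp, hD.pd_pairing j sφ hΦ.smooth_diff hp,
    hD.pd_const_mul _ _ hΦ.smooth_base hp]
  have nq : ‖φ p‖ ^ 2 = (φ p).re ^ 2 + (φ p).im ^ 2 := by
    rw [← Complex.normSq_eq_norm_sq, Complex.normSq_apply]; ring
  rw [nq]
  -- The double curl is minus the Laplacian plus the gradient of the divergence, up to the order of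
  -- mixed derivatives.
  have c := hD.pd_comm 1 2 (sB 1) hp
  have c' := hD.pd_comm 1 2 (sB 2) hp
  rcases hj with rfl | rfl <;> simp [covD, pairing]
  · linear_combination c'
  · linear_combination -c

end Equations

/-! ### Degree bounds in s. -/

section Degree

variable {D : Set Spacetime} {m : ℕ} {Φ : ℝ → Spacetime → ℂ} {A : ℝ → Fin 4 → Spacetime → ℝ}

/-- The equation is cubic in the fields. The planar and potential terms have degree at most 3(m +
1). In the directions 0 and 3 the weight adds one, but the potential has degree only m, so the total
is 1 + 2m + (m + 1). -/
protected theorem IsSmoothPoly.weightedHiggs (hD : RegularDomain D)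
    (hΦ : IsSmoothPoly D 0 ((m + 1 : ℕ) : ℕ∞) Φ)
    (hA : ∀ j ∈ ({1, 2} : Set (Fin 4)), IsSmoothPoly D 0 ((m + 1 : ℕ) : ℕ∞) (fun s => A s j))
    (hA' : ∀ j ∈ ({0, 3} : Set (Fin 4)), IsSmoothPoly D 0 (m : ℕ∞) (fun s => A s j)) :
    IsSmoothPoly D 0 ((3 * (m + 1) : ℕ) : ℕ∞)
      (fun s => weightedHiggs D ![s, -1, -1, -s] (Φ s) (A s)) := by
  have d (μ : Fin 4) {n : ℕ} (h : IsSmoothPoly D 0 (n : ℕ∞) (fun s => A s μ)) :=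
    h.covD hD μ (h.covD hD μ hΦ)
  have h1 := ((d 0 (hA' 0 (by simp))).sub (d 3 (hA' 3 (by simp)))).pow_smul 1
  have h2 := (d 1 (hA 1 (by simp))).add (d 2 (hA 2 (by simp)))
  have h3 := ((hΦ.pairing hΦ).ofReal).mul hΦ
  norm_cast at h1 h2 h3
  have up {n : ℕ} (h : n ≤ 3 * (m + 1)) : (n : ℕ∞) ≤ ((3 * (m + 1) : ℕ) : ℕ∞) := by
    exact_mod_cast h
  refine (((h1.mono (Nat.zero_le _) (up ?_)).sub (h2.mono (Nat.zero_le _) (up ?_))).add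
    (((h3.mono (Nat.zero_le _) (up ?_)).sub (hΦ.mono le_rfl (up ?_))).const_mul
      (1 / 2 : ℂ))).congr fun s p _ => ?_
  any_goals omega
  rw [weightedHiggs_param, pow_one]

protected theorem IsSmoothPoly.weightedGauge (hD : RegularDomain D)
    (hΦ : IsSmoothPoly D 0 ((m + 1 : ℕ) : ℕ∞) Φ)
    (hA : ∀ j, IsSmoothPoly D 0 ((m + 1 : ℕ) : ℕ∞) (fun s => A s j)) (j : Fin 4) :
    IsSmoothPoly D 0 ((3 * (m + 1) : ℕ) : ℕ∞)
      (fun s => weightedGauge D ![s, -1, -1, -s] (Φ s) (A s) j) := by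
  have d (μ : Fin 4) := (IsSmoothPoly.curv hD μ j (hA μ) (hA j)).pd hD μ
  have h1 := ((d 0).sub (d 3)).pow_smul 1
  have h2 := (d 1).add (d 2)
  have h3 := (hΦ.const_mul Complex.I).pairing ((hA j).covD hD j hΦ)
  norm_cast at h1 h2 h3
  have up {n : ℕ} (h : n ≤ 3 * (m + 1)) : (n : ℕ∞) ≤ ((3 * (m + 1) : ℕ) : ℕ∞) := by
    exact_mod_cast h
  refine (((h1.mono (Nat.zero_le _) (up ?_)).sub (h2.mono (Nat.zero_le _) (up ?_))).sub
    (h3.mono (Nat.zero_le _) (up ?_))).congr fun s p _ => ?_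
  any_goals omega
  rw [weightedGauge_param, pow_one]

end Degree

/-! ### The operator 𝓛 on slices and on the slab. -/

section LinearizedSlices

variable {T : ℝ} {φ χ : Spacetime → ℂ} {α a : Fin 2 → Spacetime → ℝ} {p : Spacetime}

theorem linHiggs_slice (hD : RegularDomain (slab T)) (hφ : ContDiffOn ℝ ∞ φ (slab T))
    (hα : ∀ k, ContDiffOn ℝ ∞ (α k) (slab T)) (hχ : ContDiffOn ℝ ∞ χ (slab T))
    (ha : ∀ k, ContDiffOn ℝ ∞ (a k) (slab T)) (hp : p ∈ slab T) :
    linHiggs (slice φ (p 0) (p 3)) (fun k => slice (α k) (p 0) (p 3)) (slice χ (p 0) (p 3))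
      (fun k => slice (a k) (p 0) (p 3)) (planePart p)
      = linHiggsOn (slab T) φ (α 0) (α 1) χ (a 0) (a 1) p := by
  have c (j : Fin 2) {f : Spacetime → ℂ} (hf : ContDiffOn ℝ ∞ f (slab T)) :
      covD2 (fun k => slice (α k) (p 0) (p 3)) j (slice f (p 0) (p 3))
        = slice (covD (slab T) (planeIdx j) (α j) f) (p 0) (p 3) := covD2_slice hf hp _ j rfl
  have cc (j : Fin 2) := hD.contDiffOn_covD (planeIdx j) (hα j) hχ
  simp only [linHiggs, gaugeDefect_slice ha hp, c _ hφ, c _ hχ, c _ (cc _), slice_self,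
    Fin.sum_univ_two, linHiggsOn]
  rfl

theorem linGauge_slice (hD : RegularDomain (slab T)) (hφ : ContDiffOn ℝ ∞ φ (slab T))
    (hχ : ContDiffOn ℝ ∞ χ (slab T))
    (ha : ∀ k, ContDiffOn ℝ ∞ (a k) (slab T)) (hp : p ∈ slab T) (j : Fin 2) :
    linGauge (slice φ (p 0) (p 3)) (fun k => slice (α k) (p 0) (p 3)) (slice χ (p 0) (p 3))
      (fun k => slice (a k) (p 0) (p 3)) j (planePart p)
      = linGaugeOn (slab T) φ χ (a 0) (a 1) (planeIdx j) (α j) (a j) p := by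
  have c : covD2 (fun k => slice (α k) (p 0) (p 3)) j (slice φ (p 0) (p 3))
        = slice (covD (slab T) (planeIdx j) (α j) φ) (p 0) (p 3) := covD2_slice hφ hp _ j rfl
  have pp (μ : Fin 4) (k : Fin 2) := hD.contDiffOn_pd μ (ha k)
  have hg : ContDiffOn ℝ ∞ (fun y => pd (slab T) 1 (a 0) y + pd (slab T) 2 (a 1) y
      - pairing (Complex.I * φ y) (χ y)) (slab T) :=
    ((pp 1 0).add (pp 2 1)).sub ((contDiffOn_const.mul hφ).pairing hχ)
  simp only [linGauge, gaugeDefect_slice ha hp, c, pd2_slice (ha _) hp, pd2_slice (pp _ _) hp,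
    pd2_slice hg hp, slice_self, Fin.sum_univ_two, linGaugeOn]
  rfl

end LinearizedSlices

/-! ### Rescaling to the slow variables. -/

section Rescaling

variable {E : Type*} [NormedAddCommGroup E] [NormedSpace ℝ E] {T ε : ℝ} {x : Spacetime}

/-- The factors by which the rescaling `slow ε` multiplies the coordinates. -/
def slowFactor (ε : ℝ) : Fin 4 → ℝ := ![ε, 1, 1, ε]

theorem slow_mem_slab_iff (hε : 0 < ε) : slow ε x ∈ slab T ↔ x ∈ slab (T / ε) := by
  simp only [slab, slow, Set.mem_ofPred_eq, Set.mem_Icc]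
  rw [le_div_iff₀' hε]
  simp [hε]

theorem exists_slow_eq (hε : 0 < ε) {p : Spacetime} (hp : p ∈ slab T) :
    ∃ x ∈ slab (T / ε), slow ε x = p := by
  have h : slow ε ![p 0 / ε, p 1, p 2, p 3 / ε] = p := by
    ext i
    fin_cases i <;> simp [slow, mul_div_cancel₀, hε.ne']
  exact ⟨_, (slow_mem_slab_iff hε).1 (h.symm ▸ hp), h⟩

theorem hasFDerivAt_slow (ε : ℝ) (x : Spacetime) :
    HasFDerivAt (slow ε) (ContinuousLinearMap.pi
      ![ε • ContinuousLinearMap.proj 0, ContinuousLinearMap.proj 1, ContinuousLinearMap.proj 2,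
        ε • ContinuousLinearMap.proj 3] : Spacetime →L[ℝ] Spacetime) x := by
  have h (i : Fin 4) := hasFDerivAt_apply (𝕜 := ℝ) (F' := fun _ : Fin 4 => ℝ) i x
  rw [hasFDerivAt_pi]
  intro i
  fin_cases i
  · exact (h 0).const_mul ε
  · exact h 1
  · exact h 2
  · exact (h 3).const_mul ε

theorem pd_slow (hT : 0 < T) (hε : 0 < ε) (μ : Fin 4) {f : Spacetime → E}
    (hf : ContDiffOn ℝ ∞ f (slab T)) (hx : x ∈ slab (T / ε)) :
    pd (slab (T / ε)) μ (fun x => f (slow ε x)) x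
      = slowFactor ε μ • pd (slab T) μ f (slow ε x) := by
  have h := (hf.differentiableWithinAt_infty ((slow_mem_slab_iff hε).2 hx)).hasFDerivWithinAt.comp x
    (hasFDerivAt_slow ε x).hasFDerivWithinAt (fun y hy => (slow_mem_slab_iff hε).2 hy)
  have e := h.fderivWithin ((regularDomain_slab (div_pos hT hε)).uniqueDiffOn x hx)
  simp only [pd]
  rw [show (fun x => f (slow ε x)) = f ∘ slow ε from rfl, e, ← map_smul]
  simp only [ContinuousLinearMap.comp_apply]
  congr 1
  ext i
  fin_cases μ <;> fin_cases i <;> simp [slowFactor]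

theorem contDiffOn_slow (hε : 0 < ε) {f : Spacetime → E} (hf : ContDiffOn ℝ ∞ f (slab T)) :
    ContDiffOn ℝ ∞ (fun x => f (slow ε x)) (slab (T / ε)) := by
  have h : ContDiff ℝ ∞ (slow ε) := by
    rw [contDiff_pi]
    intro i
    fin_cases i <;> simp [slow] <;> fun_prop
  exact hf.comp h.contDiffOn fun y hy => (slow_mem_slab_iff hε).2 hy

/-- The constant `c` permits iteration: one covariant derivative leaves `slowFactor ε μ` in front,
and this is the value of `c` for the second. -/
theorem covD_slow (hT : 0 < T) (hε : 0 < ε) (μ : Fin 4) (c : ℝ) {a : Spacetime → ℝ}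
    {f : Spacetime → ℂ} (hf : ContDiffOn ℝ ∞ f (slab T)) (hx : x ∈ slab (T / ε)) :
    covD (slab (T / ε)) μ (fun x => slowFactor ε μ * a (slow ε x)) (fun x => c • f (slow ε x)) x
      = (c * slowFactor ε μ) • covD (slab T) μ a f (slow ε x) := by
  have hD := regularDomain_slab (div_pos hT hε)
  simp only [covD]
  rw [hD.pd_smul c μ (contDiffOn_slow hε hf) hx, pd_slow hT hε μ hf hx]
  simp only [Complex.real_smul]
  push_cast
  ring

theorem covD_covD_slow (hT : 0 < T) (hε : 0 < ε) (μ : Fin 4) {a : Spacetime → ℝ}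
    {f : Spacetime → ℂ} (ha : ContDiffOn ℝ ∞ a (slab T)) (hf : ContDiffOn ℝ ∞ f (slab T))
    (hx : x ∈ slab (T / ε)) :
    covD (slab (T / ε)) μ (fun x => slowFactor ε μ * a (slow ε x))
        (covD (slab (T / ε)) μ (fun x => slowFactor ε μ * a (slow ε x)) (fun x => f (slow ε x))) x
      = (slowFactor ε μ ^ 2 : ℝ) • covD (slab T) μ a (covD (slab T) μ a f) (slow ε x) := by
  have hD := regularDomain_slab hT
  have e : Set.EqOn (covD (slab (T / ε)) μ (fun x => slowFactor ε μ * a (slow ε x))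
      (fun x => f (slow ε x))) (fun x => slowFactor ε μ • covD (slab T) μ a f (slow ε x))
      (slab (T / ε)) := by
    intro y hy
    have := covD_slow hT hε μ 1 (a := a) hf hy
    simpa only [one_smul, one_mul] using this
  have h := covD_slow hT hε μ (slowFactor ε μ) (a := a) (hD.contDiffOn_covD μ ha hf) hx
  rw [sq, ← h, covD_congr μ _ e hx]

/-- Origin of the weights: two derivatives in the direction 0 or 3 produce ε². -/
theorem slowFactor_sq_weights (ε : ℝ) (μ : Fin 4) :
    (![1, -1, -1, -1] : Fin 4 → ℝ) μ * slowFactor ε μ ^ 2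
      = (![ε ^ 2, -1, -1, -ε ^ 2] : Fin 4 → ℝ) μ := by
  fin_cases μ <;> simp [slowFactor]

variable {Φ : Spacetime → ℂ} {A : Fin 4 → Spacetime → ℝ}

theorem errHiggs_slow (hT : 0 < T) (hε : 0 < ε) (hΦ : ContDiffOn ℝ ∞ Φ (slab T))
    (hA : ∀ j, ContDiffOn ℝ ∞ (A j) (slab T)) (hx : x ∈ slab (T / ε)) :
    errHiggs (slab (T / ε)) (fun x => Φ (slow ε x)) (fun μ x => slowFactor ε μ * A μ (slow ε x)) x
      = weightedHiggs (slab T) ![ε ^ 2, -1, -1, -ε ^ 2] Φ A (slow ε x) := by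
  rw [errHiggs_eq_weightedHiggs]
  simp only [weightedHiggs, covD_covD_slow hT hε _ (hA _) hΦ hx, ← slowFactor_sq_weights,
    Complex.real_smul, ← mul_assoc, ← Complex.ofReal_mul]

/-- A curvature carries the scale factors of both its indices. The one for μ meets that of the
derivative and its square goes into the weight; the one for `j` is also present in the current and
comes out in front. -/
theorem errGauge_slow (hT : 0 < T) (hε : 0 < ε) (hΦ : ContDiffOn ℝ ∞ Φ (slab T))
    (hA : ∀ j, ContDiffOn ℝ ∞ (A j) (slab T)) (j : Fin 4) (hx : x ∈ slab (T / ε)) :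
    errGauge (slab (T / ε)) (fun x => Φ (slow ε x))
        (fun μ x => slowFactor ε μ * A μ (slow ε x)) j x
      = slowFactor ε j * weightedGauge (slab T) ![ε ^ 2, -1, -1, -ε ^ 2] Φ A j (slow ε x) := by
  have hD := regularDomain_slab hT
  have hD' := regularDomain_slab (div_pos hT hε)
  have c (μ : Fin 4) : Set.EqOn
      (curv (slab (T / ε)) (fun μ x => slowFactor ε μ * A μ (slow ε x)) μ j)
      (fun x => (slowFactor ε μ * slowFactor ε j) * curv (slab T) A μ j (slow ε x))
      (slab (T / ε)) := by
    intro y hy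
    simp only [curv]
    rw [hD'.pd_const_mul _ _ (contDiffOn_slow hε (hA _)) hy,
      hD'.pd_const_mul _ _ (contDiffOn_slow hε (hA _)) hy, pd_slow hT hε _ (hA _) hy,
      pd_slow hT hε _ (hA _) hy]
    simp only [smul_eq_mul]
    ring
  have d (μ : Fin 4) : pd (slab (T / ε)) μ
      (curv (slab (T / ε)) (fun μ x => slowFactor ε μ * A μ (slow ε x)) μ j) x
      = slowFactor ε j * (slowFactor ε μ ^ 2 * pd (slab T) μ (curv (slab T) A μ j) (slow ε x)) := by
    rw [pd_congr μ (c μ) hx,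
      hD'.pd_const_mul _ _ (contDiffOn_slow hε (hD.contDiffOn_curv μ j hA)) hx,
      pd_slow hT hε _ (hD.contDiffOn_curv μ j hA) hx]
    simp only [smul_eq_mul]
    ring
  have e := covD_slow hT hε j 1 (a := A j) hΦ hx
  simp only [one_smul, one_mul] at e
  rw [errGauge_eq_weightedGauge]
  simp only [weightedGauge, e, d, mul_sub, Finset.mul_sum, ← slowFactor_sq_weights]
  congr 1
  · exact Finset.sum_congr rfl fun μ _ => by ring
  · simp [pairing]
    ring

end Rescaling

/-! ### The induction step for polynomial families. -/

section Step

variable {E : Type*} [NormedAddCommGroup E] [NormedSpace ℝ E] {D : Set Spacetime}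

theorem IsVariation.of_add_pow_smul {k : ℕ} {G : ℝ → Spacetime → E} {G₀ g : Spacetime → E}
    (h₀ : ContDiffOn ℝ ∞ G₀ D) (hg : ContDiffOn ℝ ∞ g D)
    (h : IsSmoothPoly D 1 ⊤ (fun s p => G s p - G₀ p)) :
    IsVariation D k G (fun s p => G s p + s ^ k • g p) G₀ g :=
  ⟨h₀, hg, h, IsSmoothPoly.zero.congr fun s p _ => by simp⟩

variable {m : ℕ} {Φ : ℝ → Spacetime → ℂ} {A : ℝ → Fin 4 → Spacetime → ℝ}
  {φ : Spacetime → ℂ} {A₀ B : Fin 4 → Spacetime → ℝ}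

/-- If the error is of order `m + 2` in the components `0` and `3` and of order `m + 1` in the
other components, then its leading part satisfies the gauge orthogonality condition. -/
theorem gaugeOrthogonal_leading (hD : RegularDomain D) {hi : ℕ∞} (hφ : ContDiffOn ℝ ∞ φ D)
    (hΦ : IsSmoothPoly D 1 ⊤ (fun s p => Φ s p - φ p))
    (hA : ∀ j, IsSmoothPoly D 0 ⊤ (fun s => A s j))
    {Sφ : Spacetime → ℂ} {Sa : Fin 2 → Spacetime → ℝ} (hSφ : ContDiffOn ℝ ∞ Sφ D)
    (hSa : ∀ j, ContDiffOn ℝ ∞ (Sa j) D)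
    (hH : IsSmoothPoly D (m + 2) hi (fun s p =>
      weightedHiggs D ![s, -1, -1, -s] (Φ s) (A s) p - s ^ (m + 1) • Sφ p))
    (hG : ∀ j, IsSmoothPoly D (m + 2) hi (fun s p =>
      weightedGauge D ![s, -1, -1, -s] (Φ s) (A s) (planeIdx j) p - s ^ (m + 1) • Sa j p))
    (hG' : ∀ j ∈ ({0, 3} : Set (Fin 4)), IsSmoothPoly D (m + 1) ⊤ (fun s =>
      weightedGauge D ![s, -1, -1, -s] (Φ s) (A s) j)) {p : Spacetime} (hp : p ∈ D) :
    pd D 1 (Sa 0) p + pd D 2 (Sa 1) p - pairing (Complex.I * φ p) (Sφ p) = 0 := by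
  have hΦ' : IsSmoothPoly D 0 ⊤ Φ :=
    ((hΦ.mono zero_le_one le_rfl).add (.const hφ)).congr fun _ _ _ => by simp
  have h1 := hH.pairing (hΦ'.const_mul Complex.I)
  -- Replacing Φ by φ in the pairing with the leading term costs one more power of s.
  have h2 := (IsSmoothPoly.monomial (m + 1) Sφ le_rfl (hi := ⊤) le_top hSφ).pairing
    (hΦ.const_mul Complex.I)
  -- Here the weight s raises the order of the components 0 and 3 from m + 1 to m + 2, so they
  -- cannot disturb the leading coefficient.
  have h3 := ((hG' 0 (by simp)).pd hD 0).pow_smul 1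
  have h4 := ((hG' 3 (by simp)).pd hD 3).pow_smul 1
  have h5 := ((hG 0).pd hD 1).add ((hG 1).pd hD 2)
  have key : IsSmoothPoly D (m + 2) ⊤ (fun s p => s ^ (m + 1) • (pd D 1 (Sa 0) p + pd D 2 (Sa 1) p
      - pairing (Complex.I * φ p) (Sφ p))) := by
    refine ((((h1.mono le_rfl le_top).add (h2.mono le_rfl le_top)).add
      ((h3.mono le_rfl le_top).sub (h4.mono le_rfl le_top))).sub
        (h5.mono le_rfl le_top)).congr fun s p hp => ?_
    have sG := hD.contDiffOn_weightedGauge ![s, -1, -1, -s] (hΦ'.contDiffOn s)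
      (fun j => (hA j).contDiffOn s)
    have id := hD.gauge_identity ![s, -1, -1, -s] (hΦ'.contDiffOn s)
      (fun j => (hA j).contDiffOn s) hp
    rw [hD.pd_sub 1 (sG _) ((hSa 0).const_smul (s ^ (m + 1))) hp,
      hD.pd_sub 2 (sG _) ((hSa 1).const_smul (s ^ (m + 1))) hp, hD.pd_smul _ _ (hSa 0) hp,
      hD.pd_smul _ _ (hSa 1) hp]
    generalize weightedHiggs D ![s, -1, -1, -s] (Φ s) (A s) p = W at id
    simp only [Fin.sum_univ_four] at id
    simp [pairing, planeIdx, -Complex.ofReal_pow] at id ⊢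
    linear_combination -id
  exact key.eq_zero_of_pow_smul hp

/-- The induction step, in terms of families polynomial in `s = ε ^ 2`. -/
theorem exists_step_error (hD : RegularDomain D) (hm : 1 ≤ m)
    (hφ : ContDiffOn ℝ ∞ φ D) (hA₀ : ∀ j, ContDiffOn ℝ ∞ (A₀ j) D)
    (hΦ : IsSmoothPoly D 1 ⊤ (fun s p => Φ s p - φ p))
    (hA : ∀ j, IsSmoothPoly D 1 ⊤ (fun s p => A s j p - A₀ j p))
    (dΦ : IsSmoothPoly D 0 (m : ℕ∞) Φ) (dA : ∀ j, IsSmoothPoly D 0 (m : ℕ∞) (fun s => A s j))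
    {ν : Spacetime → ℂ} (hν : ContDiffOn ℝ ∞ ν D) (hB : ∀ j, ContDiffOn ℝ ∞ (B j) D)
    (hH : IsSmoothPoly D (m + 1) ⊤ (fun s => weightedHiggs D ![s, -1, -1, -s] (Φ s) (A s)))
    (hG : ∀ j : Fin 2, IsSmoothPoly D (m + 1) ⊤
      (fun s => weightedGauge D ![s, -1, -1, -s] (Φ s) (A s) (planeIdx j)))
    (hLH : ∀ p ∈ D, linHiggsOn D φ (A₀ 1) (A₀ 2) ν (B 1) (B 2) p = 0)
    (hLG : ∀ j : Fin 2, ∀ p ∈ D, linGaugeOn D φ ν (B 1) (B 2) (planeIdx j) (A₀ (planeIdx j))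
      (B (planeIdx j)) p = 0)
    (hG' : ∀ j ∈ ({0, 3} : Set (Fin 4)), IsSmoothPoly D (m + 1) ⊤ (fun s =>
      weightedGauge D ![s, -1, -1, -s] (fun p => Φ s p + s ^ m • ν p)
        (fun j p => A s j p + s ^ m • B j p) j)) :
    ∃ (Sφ : Spacetime → ℂ) (Sa : Fin 2 → Spacetime → ℝ),
      ContDiffOn ℝ ∞ Sφ D ∧ (∀ j, ContDiffOn ℝ ∞ (Sa j) D) ∧
      (∀ (ψ : Spacetime → ℂ) (Ψ : Fin 4 → Spacetime → ℝ), ContDiffOn ℝ ∞ ψ D →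
        (∀ j, ContDiffOn ℝ ∞ (Ψ j) D) → (∀ j ∈ ({0, 3} : Set (Fin 4)), Ψ j = fun _ => 0) →
        IsSmoothPoly D (m + 2) ((3 * (m + 1) : ℕ) : ℕ∞) (fun s p =>
          weightedHiggs D ![s, -1, -1, -s] (fun p => Φ s p + s ^ m • ν p + s ^ (m + 1) • ψ p)
            (fun j p => A s j p + s ^ m • B j p + s ^ (m + 1) • Ψ j p) p
          - s ^ (m + 1) • (linHiggsOn D φ (A₀ 1) (A₀ 2) ψ (Ψ 1) (Ψ 2) p + Sφ p)) ∧
        ∀ j : Fin 2, IsSmoothPoly D (m + 2) ((3 * (m + 1) : ℕ) : ℕ∞) (fun s p =>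
          weightedGauge D ![s, -1, -1, -s] (fun p => Φ s p + s ^ m • ν p + s ^ (m + 1) • ψ p)
            (fun j p => A s j p + s ^ m • B j p + s ^ (m + 1) • Ψ j p) (planeIdx j) p
          - s ^ (m + 1) • (linGaugeOn D φ ψ (Ψ 1) (Ψ 2) (planeIdx j) (A₀ (planeIdx j))
            (Ψ (planeIdx j)) p + Sa j p))) ∧
      ∀ p ∈ D, pd D 1 (Sa 0) p + pd D 2 (Sa 1) p - pairing (Complex.I * φ p) (Sφ p) = 0 := by
  have hj (j : Fin 2) : planeIdx j = 1 ∨ planeIdx j = 2 := by fin_cases j <;> simp [planeIdx]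
  have up (n : ℕ) (hn : n ≤ m + 1) : (n : ℕ∞) ≤ ((m + 1 : ℕ) : ℕ∞) := by exact_mod_cast hn
  have vΦ : IsVariation D m Φ (fun s p => Φ s p + s ^ m • ν p) φ ν := .of_add_pow_smul hφ hν hΦ
  have vA (j : Fin 4) : IsVariation D m (fun s => A s j) (fun s p => A s j p + s ^ m • B j p)
      (A₀ j) (B j) := .of_add_pow_smul (hA₀ j) (hB j) (hA j)
  -- At order m the error changes by 𝓛 of the zero mode part, which vanishes by `hLH`.
  have hH₁ : IsSmoothPoly D (m + 1) ⊤ (fun s => weightedHiggs D ![s, -1, -1, -s]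
      (fun p => Φ s p + s ^ m • ν p) (fun j p => A s j p + s ^ m • B j p)) :=
    ((vΦ.weightedHiggs hD hm vA).choose_spec.diff.add hH).congr fun s p hp => by simp [hLH p hp]
  have hG₁ (j : Fin 2) : IsSmoothPoly D (m + 1) ⊤ (fun s => weightedGauge D ![s, -1, -1, -s]
      (fun p => Φ s p + s ^ m • ν p) (fun j p => A s j p + s ^ m • B j p) (planeIdx j)) :=
    ((vΦ.weightedGauge hD hm vA (hj j)).choose_spec.diff.add (hG j)).congr fun s p hp => by simp [hLG j p hp]
  -- The leading coefficients are taken at ψ = 0, hence depend on neither s nor ψ.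
  obtain ⟨Sφ, sSφ, hSφ⟩ := hH₁.exists_leading
  choose Sa sSa hSa using fun j => (hG₁ j).exists_leading
  -- As m ≥ 1, the zero mode term does not move the base point at s = 0, so the next linearization
  -- is again taken at the vortex.
  have bΦ : IsSmoothPoly D 1 ⊤ (fun s p => Φ s p + s ^ m • ν p - φ p) :=
    (hΦ.add (.monomial m ν hm le_top hν)).congr fun s p _ => by abel
  have bA (j : Fin 4) : IsSmoothPoly D 1 ⊤ (fun s p => A s j p + s ^ m • B j p - A₀ j p) :=
    ((hA j).add (.monomial m (B j) hm le_top (hB j))).congr fun s p _ => by abel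
  refine ⟨Sφ, Sa, sSφ, sSa, fun ψ Ψ hψ hΨ hΨ0 => ?_, fun p hp => ?_⟩
  · have vΦ' : IsVariation D (m + 1) (fun s p => Φ s p + s ^ m • ν p)
      (fun s p => Φ s p + s ^ m • ν p + s ^ (m + 1) • ψ p) φ ψ := .of_add_pow_smul hφ hψ bΦ
    have vA' (j : Fin 4) : IsVariation D (m + 1) (fun s p => A s j p + s ^ m • B j p)
        (fun s p => A s j p + s ^ m • B j p + s ^ (m + 1) • Ψ j p) (A₀ j) (Ψ j) :=
      .of_add_pow_smul (hA₀ j) (hΨ j) (bA j)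
    have d0 (j : Fin 4) : IsSmoothPoly D 0 (m : ℕ∞) (fun s p => A s j p + s ^ m • B j p) :=
      (dA j).add (.monomial m (B j) (Nat.zero_le _) le_rfl (hB j))
    have d1 (j : Fin 4) : IsSmoothPoly D 0 ((m + 1 : ℕ) : ℕ∞)
        (fun s p => A s j p + s ^ m • B j p + s ^ (m + 1) • Ψ j p) :=
      ((d0 j).mono le_rfl (up _ (by omega))).add (.monomial _ (Ψ j) (Nat.zero_le _) le_rfl (hΨ j))
    have d2 (j : Fin 4) (hj : j ∈ ({0, 3} : Set (Fin 4))) : IsSmoothPoly D 0 (m : ℕ∞)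
        (fun s p => A s j p + s ^ m • B j p + s ^ (m + 1) • Ψ j p) :=
      (d0 j).congr fun s p _ => by simp [hΨ0 j hj]
    have d3 : IsSmoothPoly D 0 ((m + 1 : ℕ) : ℕ∞)
        (fun s p => Φ s p + s ^ m • ν p + s ^ (m + 1) • ψ p) :=
      ((dΦ.mono le_rfl (up _ (by omega))).add (.monomial m ν (Nat.zero_le _) (up _ (by omega))
        hν)).add (.monomial _ ψ (Nat.zero_le _) le_rfl hψ)
    have up' : ((m + 1 : ℕ) : ℕ∞) ≤ ((3 * (m + 1) : ℕ) : ℕ∞) := by exact_mod_cast by omega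
    constructor
    · obtain ⟨_, v⟩ := vΦ'.weightedHiggs hD (by omega) vA'
      have h := IsSmoothPoly.weightedHiggs hD d3 (fun j _ => d1 j) d2
      -- The order comes from the variation, the degree from the count `h`.
      exact ((v.diff.add hSφ).congr fun s p _ => by rw [smul_add]; abel).inter
        (h.sub (.monomial (m + 1) _ (Nat.zero_le _) up' (v.smooth_diff.add sSφ)))
    · intro j
      obtain ⟨_, v⟩ := vΦ'.weightedGauge hD (by omega) vA' (hj j)
      have h := IsSmoothPoly.weightedGauge hD d3 d1 (planeIdx j)
      exact ((v.diff.add (hSa j)).congr fun s p _ => by rw [smul_add]; abel).inter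
        (h.sub (.monomial (m + 1) _ (Nat.zero_le _) up' (v.smooth_diff.add (sSa j))))
  · exact gaugeOrthogonal_leading hD hφ bΦ
      (fun j => (vA j).isSmoothPoly') sSφ sSa hSφ hSa hG' hp

end Step

/-! ### Zero modes lie in the kernel of 𝓛. -/

section ZeroModes

variable {E : Type*} [NormedAddCommGroup E] [NormedSpace ℝ E] {T : ℝ} {N : ℕ}
  {q : ℝ × ℝ → Fin N → ℂ} {φ : Spacetime → ℂ} {α : Fin 2 → Spacetime → ℝ}

theorem contDiffOn_slowCoeff {c : ℝ × ℝ → ℝ} (hc : ContDiffOn ℝ ∞ c (Set.Icc 0 T ×ˢ Set.univ)) :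
    ContDiffOn ℝ ∞ (fun p : Spacetime => c (p 0, p 3)) (slab T) := by
  have h : ContDiff ℝ ∞ (fun p : Spacetime => (p 0, p 3)) := by fun_prop
  exact hc.comp h.contDiffOn fun p hp => ⟨hp, trivial⟩

theorem contDiffOn_sum_slowCoeff {ι : Type*} [Fintype ι] {c : ι → ℝ × ℝ → ℝ}
    (hc : ∀ μ, ContDiffOn ℝ ∞ (c μ) (Set.Icc 0 T ×ˢ Set.univ)) {f : ι → Spacetime → E}
    (hf : ∀ μ, ContDiffOn ℝ ∞ (f μ) (slab T)) :
    ContDiffOn ℝ ∞ (fun p => ∑ μ, c μ (p 0, p 3) • f μ p) (slab T) :=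
  ContDiffOn.sum fun μ _ => (contDiffOn_slowCoeff (hc μ)).smul (hf μ)

/-- Functions of the slow variables are constants for the derivatives in the plane. -/
theorem pd_planeIdx_sum_slowCoeff (hT : 0 < T) {ι : Type*} [Fintype ι] {c : ι → ℝ × ℝ → ℝ}
    (hc : ∀ μ, ContDiffOn ℝ ∞ (c μ) (Set.Icc 0 T ×ˢ Set.univ)) {f : ι → Spacetime → E}
    (hf : ∀ μ, ContDiffOn ℝ ∞ (f μ) (slab T)) (j : Fin 2) {p : Spacetime} (hp : p ∈ slab T) :
    pd (slab T) (planeIdx j) (fun p => ∑ μ, c μ (p 0, p 3) • f μ p) p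
      = ∑ μ, c μ (p 0, p 3) • pd (slab T) (planeIdx j) (f μ) p := by
  have hD := regularDomain_slab hT
  -- Freezing the coefficients at `p` does not change the planar slice through `p`, hence not the
  -- planar derivatives there.
  have hs (μ : ι) : ContDiffOn ℝ ∞ (fun y => c μ (p 0, p 3) • f μ y) (slab T) :=
    (hf μ).const_smul _
  have h1 := pd2_slice (τ := p 0) (ζ := p 3) (contDiffOn_sum_slowCoeff hc hf) hp j
  have h2 := pd2_slice (τ := p 0) (ζ := p 3) (ContDiffOn.sum (s := Finset.univ)
    fun μ _ => hs μ) hp j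
  have h3 := congrFun (h1.symm.trans h2) (planePart p)
  rw [slice_self, slice_self, hD.pd_sum _ _ (fun μ _ => hs μ) hp] at h3
  simpa only [fun μ => hD.pd_smul (c μ (p 0, p 3)) (planeIdx j) (hf μ) hp] using h3

variable {nφ : Fin (2 * N) → Spacetime → ℂ} {na : Fin (2 * N) → Fin 2 → Spacetime → ℝ}

theorem IsZeroModeFrame.linearized (h : IsZeroModeFrame N T φ α nφ na) (μ : Fin (2 * N)) :
    ∀ p ∈ slab T,
      (covD (slab T) 1 (α 0) (nφ μ) p + Complex.I * covD (slab T) 2 (α 1) (nφ μ) p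
        - Complex.I * ((na μ 0 p : ℂ) + Complex.I * (na μ 1 p : ℂ)) * φ p = 0) ∧
      (pd (slab T) 1 (na μ 1) p - pd (slab T) 2 (na μ 0) p + pairing (φ p) (nφ μ p) = 0) ∧
      (pd (slab T) 1 (na μ 0) p + pd (slab T) 2 (na μ 1) p
        - pairing (Complex.I * φ p) (nφ μ p) = 0) := by
  intro p hp
  have z := h.zero_mode μ (p 0) hp (p 3)
  refine ⟨?_, ?_, ?_⟩
  · have := z.linearized_higgs (planePart p)
    rwa [covD2_slice (h.smooth_higgs μ) hp _ 0 rfl, covD2_slice (h.smooth_higgs μ) hp _ 1 rfl,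
      slice_self, slice_self, slice_self, slice_self, slice_self] at this
  · have := z.linearized_gauge (planePart p)
    rwa [curv2, pd2_slice (h.smooth_gauge μ 1) hp, pd2_slice (h.smooth_gauge μ 0) hp,
      slice_self, slice_self, slice_self, slice_self] at this
  · exact (gaugeOrthogonal_slice_iff (h.smooth_gauge μ)).1
      (fun τ hτ ζ => (h.zero_mode μ τ hτ ζ).gauge_orthogonal) p hp

theorem pairing_sum_smul {ι : Type*} [Fintype ι] (z : ℂ) (c : ι → ℝ) (f : ι → ℂ) :
    pairing z (∑ μ, c μ • f μ) = ∑ μ, c μ * pairing z (f μ) := by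
  simp only [pairing, map_sum, Finset.mul_sum, Complex.re_sum]
  refine Finset.sum_congr rfl fun μ _ => ?_
  simp
  ring

/-- Combinations of zero modes with coefficients depending on the slow variables lie in the kernel
of the linearized operator. -/
theorem IsZeroModeFrame.lin_sum_eq_zero (hT : 0 < T) (hq : IsVortexLift T q φ α)
    (h : IsZeroModeFrame N T φ α nφ na) {c : Fin (2 * N) → ℝ × ℝ → ℝ}
    (hc : ∀ μ, ContDiffOn ℝ ∞ (c μ) (Set.Icc 0 T ×ˢ Set.univ)) {ν : Spacetime → ℂ}
    {B : Fin 2 → Spacetime → ℝ} (hν : ν = fun p => ∑ μ, c μ (p 0, p 3) • nφ μ p)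
    (hB : ∀ j, B j = fun p => ∑ μ, c μ (p 0, p 3) • na μ j p) {p : Spacetime} (hp : p ∈ slab T) :
    linHiggsOn (slab T) φ (α 0) (α 1) ν (B 0) (B 1) p = 0 ∧
    ∀ j : Fin 2, linGaugeOn (slab T) φ ν (B 0) (B 1) (planeIdx j) (α j) (B j) p = 0 := by
  have hD := regularDomain_slab hT
  have sν : ContDiffOn ℝ ∞ ν (slab T) := hν ▸ contDiffOn_sum_slowCoeff hc h.smooth_higgs
  have sB (j) : ContDiffOn ℝ ∞ (B j) (slab T) :=
    hB j ▸ contDiffOn_sum_slowCoeff hc fun μ => h.smooth_gauge μ j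
  have dν (j : Fin 2) {p} (hp : p ∈ slab T) : pd (slab T) (planeIdx j) ν p
      = ∑ μ, c μ (p 0, p 3) • pd (slab T) (planeIdx j) (nφ μ) p :=
    hν ▸ pd_planeIdx_sum_slowCoeff hT hc h.smooth_higgs j hp
  have dB (j k : Fin 2) {p} (hp : p ∈ slab T) : pd (slab T) (planeIdx j) (B k) p
      = ∑ μ, c μ (p 0, p 3) • pd (slab T) (planeIdx j) (na μ k) p :=
    hB k ▸ pd_planeIdx_sum_slowCoeff hT hc (fun μ => h.smooth_gauge μ k) j hp
  obtain ⟨B1, B2⟩ := hq.bogomolny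
  -- The first order equations contain planar derivatives only, so they are linear over functions of
  -- (τ, ζ).
  have l1 : ∀ p ∈ slab T, covD (slab T) 1 (α 0) ν p + Complex.I * covD (slab T) 2 (α 1) ν p
      - Complex.I * ((B 0 p : ℂ) + Complex.I * (B 1 p : ℂ)) * φ p = 0 := by
    intro p hp
    rw [← Finset.sum_eq_zero (s := Finset.univ) (f := fun μ => (c μ (p 0, p 3) : ℂ) *
      (covD (slab T) 1 (α 0) (nφ μ) p + Complex.I * covD (slab T) 2 (α 1) (nφ μ) p
        - Complex.I * ((na μ 0 p : ℂ) + Complex.I * (na μ 1 p : ℂ)) * φ p))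
      (fun μ _ => by rw [(h.linearized μ p hp).1, mul_zero])]
    have d0 := dν 0 hp
    have d1 := dν 1 hp
    simp only [planeIdx, Matrix.cons_val_zero, Matrix.cons_val_one] at d0 d1
    simp only [covD, d0, d1]
    simp only [hν, hB, Complex.real_smul, smul_eq_mul, Complex.ofReal_sum, Complex.ofReal_mul,
      Finset.mul_sum, Finset.sum_mul, ← Finset.sum_add_distrib, ← Finset.sum_sub_distrib]
    exact Finset.sum_congr rfl fun μ _ => by ring
  have l2 : ∀ p ∈ slab T, pd (slab T) 1 (B 1) p - pd (slab T) 2 (B 0) p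
      + pairing (φ p) (ν p) = 0 := by
    intro p hp
    rw [← Finset.sum_eq_zero (s := Finset.univ) (f := fun μ => c μ (p 0, p 3) *
      (pd (slab T) 1 (na μ 1) p - pd (slab T) 2 (na μ 0) p + pairing (φ p) (nφ μ p)))
      (fun μ _ => by rw [(h.linearized μ p hp).2.1, mul_zero])]
    have d0 := dB 0 1 hp
    have d1 := dB 1 0 hp
    simp only [planeIdx, Matrix.cons_val_zero, Matrix.cons_val_one] at d0 d1
    rw [d0, d1, hν]
    simp only [pairing_sum_smul, smul_eq_mul, ← Finset.sum_add_distrib, ← Finset.sum_sub_distrib]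
    exact Finset.sum_congr rfl fun μ _ => by ring
  have l3 : ∀ p ∈ slab T, pd (slab T) 1 (B 0) p + pd (slab T) 2 (B 1) p
      - pairing (Complex.I * φ p) (ν p) = 0 := by
    intro p hp
    rw [← Finset.sum_eq_zero (s := Finset.univ) (f := fun μ => c μ (p 0, p 3) *
      (pd (slab T) 1 (na μ 0) p + pd (slab T) 2 (na μ 1) p
        - pairing (Complex.I * φ p) (nφ μ p)))
      (fun μ _ => by rw [(h.linearized μ p hp).2.2, mul_zero])]
    have d0 := dB 0 0 hp
    have d1 := dB 1 1 hp
    simp only [planeIdx, Matrix.cons_val_zero, Matrix.cons_val_one] at d0 d1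
    rw [d0, d1, hν]
    simp only [pairing_sum_smul, smul_eq_mul, ← Finset.sum_add_distrib, ← Finset.sum_sub_distrib]
    exact Finset.sum_congr rfl fun μ _ => by ring
  have hα := hq.smooth_gauge
  refine ⟨?_, fun j => ?_⟩
  · rw [linHiggsOn, hD.linearized_higgs hq.smooth_higgs (hα 0) (hα 1) sν (sB 0) (sB 1) B1 B2
      l1 l2 l3 hp, l3 p hp]
    simp
  · have g := hD.linearized_gauge hq.smooth_higgs sν (sB 0) (sB 1) B1 l1 l2 l3 hp
    rw [linGaugeOn, pd_eq_zero _ l3 hp, add_zero]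
    fin_cases j
    exacts [g.1, g.2]

end ZeroModes

/-! ### Expansions in ε against polynomials in s = ε². -/

section Expansions

variable {E : Type*} [NormedAddCommGroup E] [NormedSpace ℝ E] {T ε₀ : ℝ} {lo hi : ℕ}

/-- For given s the choice ε = √s reaches every slow point, and ε < ε₀ becomes s < ε₀². -/
theorem IsSmoothPoly.of_hasExpansion (hε₀ : 0 < ε₀) {k : ℕ} {n : ℕ∞}
    {G F : ℝ → Spacetime → E} (hG : IsSmoothPoly (slab T) k n G)
    (h : HasExpansion T ε₀ F (fun i => 2 * i) lo hi)
    (hF : ∀ ε > 0, ∀ x ∈ slab (T / ε), F ε x = G (ε ^ 2) (slow ε x)) :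
    IsSmoothPoly (slab T) lo ⊤ G := by
  obtain ⟨f, hf⟩ := h
  refine hG.of_expansion (pow_pos hε₀ 2) (m := hi) (f := f) fun s hs p hp => ?_
  have hpos := Real.sqrt_pos.2 hs.1
  obtain ⟨x, hx, rfl⟩ := exists_slow_eq hpos hp
  have := hf (√s) ⟨hpos, (Real.sqrt_lt' hε₀).2 hs.2⟩ x hx
  rw [hF _ hpos x hx] at this
  simpa only [pow_mul, Real.sq_sqrt hs.1.le] using this

/-- Since 2i - 1 = 1 + 2(i - 1), one factor ε cancels and the index drops by one. Writing the range
as `lo + 1` to `hi + 1` keeps i ≥ 1, so the natural subtraction is exact. -/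
theorem IsSmoothPoly.of_hasExpansion_odd (hε₀ : 0 < ε₀) {k : ℕ} {n : ℕ∞}
    {G F : ℝ → Spacetime → ℝ} (hG : IsSmoothPoly (slab T) k n G)
    (h : HasExpansion T ε₀ F (fun i => 2 * i - 1) (lo + 1) (hi + 1))
    (hF : ∀ ε > 0, ∀ x ∈ slab (T / ε), F ε x = ε * G (ε ^ 2) (slow ε x)) :
    IsSmoothPoly (slab T) lo ⊤ G := by
  obtain ⟨f, hf⟩ := h
  refine hG.of_expansion (pow_pos hε₀ 2) (m := hi) (f := fun i => f (i + 1)) fun s hs p hp => ?_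
  have hpos := Real.sqrt_pos.2 hs.1
  obtain ⟨x, hx, rfl⟩ := exists_slow_eq hpos hp
  have := hf (√s) ⟨hpos, (Real.sqrt_lt' hε₀).2 hs.2⟩ x hx
  rw [hF _ hpos x hx, Real.sq_sqrt hs.1.le, ← Finset.map_add_right_Icc, Finset.sum_map] at this
  refine mul_left_cancel₀ hpos.ne' (this.trans ?_)
  rw [Finset.mul_sum]
  refine Finset.sum_congr rfl fun i _ => ?_
  beta_reduce
  rw [addRightEmbedding_apply, show 2 * (i + 1) - 1 = 2 * i + 1 by omega, pow_succ, pow_mul,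
    Real.sq_sqrt hs.1.le]
  simp only [smul_eq_mul]
  ring

theorem IsSmoothPoly.hasExpansion {G F : ℝ → Spacetime → E}
    (hG : IsSmoothPoly (slab T) lo (hi : ℕ∞) G)
    (hF : ∀ ε > 0, ∀ x ∈ slab (T / ε), F ε x = G (ε ^ 2) (slow ε x)) :
    HasExpansion T ε₀ F (fun i => 2 * i) lo hi := by
  obtain ⟨f, hf⟩ := hG.exists_expansion
  refine ⟨f, fun ε hε x hx => ?_⟩
  rw [hF ε hε.1 x hx, hf _ _ ((slow_mem_slab_iff hε.1).2 hx)]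
  simp only [pow_mul]

end Expansions

/-! ### The ansatz as a polynomial in s. -/

section Profiles

variable {T : ℝ} {N m : ℕ} {φ : Spacetime → ℂ} {α : Fin 2 → Spacetime → ℝ}
  {φs : ℕ → Spacetime → ℂ} {as : Fin 4 → ℕ → Spacetime → ℝ}

/-- The Higgs field of the ansatz as a function of `s = ε ^ 2` and the slow variables. -/
def profileHiggs (φ : Spacetime → ℂ) (φs : ℕ → Spacetime → ℂ) (m : ℕ) (s : ℝ) : Spacetime → ℂ :=
  fun p => φ p + ∑ i ∈ Finset.Icc 1 m, s ^ i • φs i p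

/-- The gauge field of the ansatz as a function of `s = ε ^ 2` and the slow variables, with a
factor `ε` taken out of the components `0` and `3`. -/
def profileGauge (α : Fin 2 → Spacetime → ℝ) (as : Fin 4 → ℕ → Spacetime → ℝ) (m : ℕ) (s : ℝ) :
    Fin 4 → Spacetime → ℝ :=
  ![fun p => ∑ i ∈ Finset.Icc 1 m, s ^ (i - 1) • as 0 i p,
    fun p => α 0 p + ∑ i ∈ Finset.Icc 1 m, s ^ i • as 1 i p,
    fun p => α 1 p + ∑ i ∈ Finset.Icc 1 m, s ^ i • as 2 i p,
    fun p => ∑ i ∈ Finset.Icc 1 m, s ^ (i - 1) • as 3 i p]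

theorem ansatzHiggs_eq (ε : ℝ) :
    ansatzHiggs φ φs m ε = fun x => profileHiggs φ φs m (ε ^ 2) (slow ε x) := by
  ext x
  simp only [ansatzHiggs, profileHiggs, pow_mul]

theorem sum_odd_pow (ε : ℝ) (f : ℕ → ℝ) :
    ∑ i ∈ Finset.Icc 1 m, ε ^ (2 * i - 1) * f i
      = ε * ∑ i ∈ Finset.Icc 1 m, (ε ^ 2) ^ (i - 1) * f i := by
  rw [Finset.mul_sum]
  refine Finset.sum_congr rfl fun i hi => ?_
  have := (Finset.mem_Icc.1 hi).1
  rw [← pow_mul, show 2 * i - 1 = 2 * (i - 1) + 1 by omega, pow_succ]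
  ring

theorem ansatzGauge_eq (ε : ℝ) : ansatzGauge α as m ε
    = fun j x => slowFactor ε j * profileGauge α as m (ε ^ 2) j (slow ε x) := by
  ext j x
  fin_cases j <;> simp [ansatzGauge, profileGauge, slowFactor, sum_odd_pow, pow_mul]

theorem stepHiggs_eq {c : Fin (2 * N) → ℝ × ℝ → ℝ} {nφ : Fin (2 * N) → Spacetime → ℂ}
    (ψ : Spacetime → ℂ) (ε : ℝ) :
    stepHiggs φ φs m c nφ ψ ε = fun x => profileHiggs φ φs m (ε ^ 2) (slow ε x)
      + (ε ^ 2) ^ m • ∑ μ, c μ ((slow ε x) 0, (slow ε x) 3) • nφ μ (slow ε x)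
      + (ε ^ 2) ^ (m + 1) • ψ (slow ε x) := by
  ext x
  simp only [stepHiggs, ansatzHiggs_eq, ← pow_mul]
  rfl

theorem stepGauge_eq {c : Fin (2 * N) → ℝ × ℝ → ℝ} {na : Fin (2 * N) → Fin 2 → Spacetime → ℝ}
    {b₀ b₃ : Spacetime → ℝ} (ψ : Fin 2 → Spacetime → ℝ) (ε : ℝ) :
    stepGauge α as m c na b₀ b₃ ψ ε = fun j x => slowFactor ε j *
      (profileGauge α as m (ε ^ 2) j (slow ε x)
      + (ε ^ 2) ^ m • (![b₀, fun p => ∑ μ, c μ (p 0, p 3) • na μ 0 p,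
          fun p => ∑ μ, c μ (p 0, p 3) • na μ 1 p, b₃] : Fin 4 → Spacetime → ℝ) j (slow ε x)
      + (ε ^ 2) ^ (m + 1) • (![fun _ => 0, ψ 0, ψ 1, fun _ => 0] : Fin 4 → Spacetime → ℝ) j
        (slow ε x)) := by
  ext j x
  have e1 : (slow ε x) 0 = ε * x 0 := rfl
  have e2 : (slow ε x) 3 = ε * x 3 := rfl
  fin_cases j <;> simp [stepGauge, ansatzGauge_eq, slowFactor, e1, e2] <;> ring

theorem isSmoothPoly_profileHiggs {D : Set Spacetime} (hφ : ContDiffOn ℝ ∞ φ D)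
    (hφs : ∀ i ∈ Finset.Icc 1 m, ContDiffOn ℝ ∞ (φs i) D) :
    IsSmoothPoly D 0 (m : ℕ∞) (profileHiggs φ φs m) ∧
    IsSmoothPoly D 1 ⊤ (fun s p => profileHiggs φ φs m s p - φ p) := by
  have h : IsSmoothPoly D 1 (m : ℕ∞) (fun s p => ∑ i ∈ Finset.Icc 1 m, s ^ i • φs i p) :=
    .sum _ fun i hi => .monomial i _ (Finset.mem_Icc.1 hi).1
      (by exact_mod_cast (Finset.mem_Icc.1 hi).2) (hφs i hi)
  exact ⟨(IsSmoothPoly.const hφ).add (h.mono zero_le_one le_rfl),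
    (h.mono le_rfl le_top).congr fun s p _ => by simp [profileHiggs]⟩

/-- The leading part of the gauge field of the ansatz. The components `0` and `3` are determined by
the first corrections. -/
theorem exists_profileGauge_base {D : Set Spacetime} (hα : ∀ j, ContDiffOn ℝ ∞ (α j) D)
    (has : ∀ j, ∀ i ∈ Finset.Icc 1 m, ContDiffOn ℝ ∞ (as j i) D) :
    (∀ j, IsSmoothPoly D 0 (m : ℕ∞) (fun s => profileGauge α as m s j)) ∧
    ∃ A₀ : Fin 4 → Spacetime → ℝ, A₀ 1 = α 0 ∧ A₀ 2 = α 1 ∧ (∀ j, ContDiffOn ℝ ∞ (A₀ j) D) ∧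
      ∀ j, IsSmoothPoly D 1 ⊤ (fun s p => profileGauge α as m s j p - A₀ j p) := by
  have h (j : Fin 4) : IsSmoothPoly D 1 (m : ℕ∞)
      (fun s p => ∑ i ∈ Finset.Icc 1 m, s ^ i • as j i p) :=
    .sum _ fun i hi => .monomial i _ (Finset.mem_Icc.1 hi).1
      (by exact_mod_cast (Finset.mem_Icc.1 hi).2) (has j i hi)
  have h' (j : Fin 4) : IsSmoothPoly D 0 (m : ℕ∞)
      (fun s p => ∑ i ∈ Finset.Icc 1 m, s ^ (i - 1) • as j i p) :=
    .sum _ fun i hi => .monomial (i - 1) _ (Nat.zero_le _)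
      (by exact_mod_cast (Nat.sub_le _ _).trans (Finset.mem_Icc.1 hi).2) (has j i hi)
  have hh (j : Fin 4) (k : Fin 2) : IsSmoothPoly D 0 (m : ℕ∞)
      (fun s p => α k p + ∑ i ∈ Finset.Icc 1 m, s ^ i • as j i p) :=
    (IsSmoothPoly.const (hα k)).add ((h j).mono zero_le_one le_rfl)
  obtain ⟨g₀, sg₀, hg₀⟩ := (h' 0).exists_leading
  obtain ⟨g₃, sg₃, hg₃⟩ := (h' 3).exists_leading
  refine ⟨fun j => ?_, ![g₀, α 0, α 1, g₃], rfl, rfl, fun j => ?_, fun j => ?_⟩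
  · fin_cases j
    exacts [h' 0, hh 1 0, hh 2 1, h' 3]
  · fin_cases j
    exacts [sg₀, hα 0, hα 1, sg₃]
  · fin_cases j
    · exact (hg₀.mono le_rfl le_top).congr fun s p _ => by simp [profileGauge]
    · exact ((h 1).mono le_rfl le_top).congr fun s p _ => by simp [profileGauge]
    · exact ((h 2).mono le_rfl le_top).congr fun s p _ => by simp [profileGauge]
    · exact (hg₃.mono le_rfl le_top).congr fun s p _ => by simp [profileGauge]

end Profiles

/-! ### Assembly of the induction step and the theorem. -/

/-- The vector `S_{m+1}` of the induction step exists and satisfies the gauge orthogonality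
condition. -/
theorem exists_isStepError {T : ℝ} (hT : 0 < T) {N : ℕ} {q : ℝ × ℝ → Fin N → ℂ}
    {φ : Spacetime → ℂ} {α : Fin 2 → Spacetime → ℝ} (hq : IsVortexLift T q φ α)
    {nφ : Fin (2 * N) → Spacetime → ℂ} {na : Fin (2 * N) → Fin 2 → Spacetime → ℝ}
    (hn : IsZeroModeFrame N T φ α nφ na) {ε₀ : ℝ} (hε₀ : 0 < ε₀) {m : ℕ} (hm : 1 ≤ m)
    {φs : ℕ → Spacetime → ℂ} {as : Fin 4 → ℕ → Spacetime → ℝ}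
    (ha : IsApproxSolution T ε₀ φ α m φs as) {c : Fin (2 * N) → ℝ × ℝ → ℝ}
    (hc : ∀ μ, ContDiffOn ℝ ∞ (c μ) (Set.Icc 0 T ×ˢ Set.univ)) {b₀ b₃ : Spacetime → ℝ}
    (hb₀ : ContDiffOn ℝ ∞ b₀ (slab T)) (hb₃ : ContDiffOn ℝ ∞ b₃ (slab T))
    (hb : ∀ j ∈ ({0, 3} : Set (Fin 4)), HasExpansion T ε₀
      (fun ε => errGauge (slab (T / ε)) (stepHiggs φ φs m c nφ 0 ε)
        (stepGauge α as m c na b₀ b₃ 0 ε) j)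
      (fun i => 2 * i - 1) (m + 2) (3 * (m + 1))) :
    ∃ (Sφ : Spacetime → ℂ) (Sa : Fin 2 → Spacetime → ℝ),
      ContDiffOn ℝ ∞ Sφ (slab T) ∧ (∀ j, ContDiffOn ℝ ∞ (Sa j) (slab T)) ∧
      IsStepError T ε₀ φ α m φs as c nφ na b₀ b₃ Sφ Sa ∧
      ∀ τ ∈ Set.Icc 0 T, ∀ ζ : ℝ,
        GaugeOrthogonal (slice φ τ ζ) (slice Sφ τ ζ) (fun j => slice (Sa j) τ ζ) := by
  have hD := regularDomain_slab hT
  have hφ := hq.smooth_higgs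
  have hα := hq.smooth_gauge
  obtain ⟨dΦ, bΦ⟩ := isSmoothPoly_profileHiggs hφ ha.smooth_higgs
  obtain ⟨dA, A₀, hA1, hA2, sA₀, bA⟩ := exists_profileGauge_base hα ha.smooth_gauge
  have hAk (k : Fin 2) : A₀ (planeIdx k) = α k := by fin_cases k <;> assumption
  have up : (m : ℕ∞) ≤ ((m + 1 : ℕ) : ℕ∞) := by exact_mod_cast m.le_succ
  set ν : Spacetime → ℂ := fun p => ∑ μ, c μ (p 0, p 3) • nφ μ p with hν
  set B : Fin 4 → Spacetime → ℝ := ![b₀, fun p => ∑ μ, c μ (p 0, p 3) • na μ 0 p,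
    fun p => ∑ μ, c μ (p 0, p 3) • na μ 1 p, b₃] with hB
  have sν : ContDiffOn ℝ ∞ ν (slab T) := contDiffOn_sum_slowCoeff hc hn.smooth_higgs
  have sB (j : Fin 4) : ContDiffOn ℝ ∞ (B j) (slab T) := by
    fin_cases j
    exacts [hb₀, contDiffOn_sum_slowCoeff hc fun μ => hn.smooth_gauge μ 0,
      contDiffOn_sum_slowCoeff hc fun μ => hn.smooth_gauge μ 1, hb₃]
  have hL {p : Spacetime} (hp : p ∈ slab T) :=
    hn.lin_sum_eq_zero hT hq hc hν (B := ![B 1, B 2]) (by intro j; fin_cases j <;> rfl) hp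
  have hH : IsSmoothPoly (slab T) (m + 1) ⊤ (fun s => weightedHiggs (slab T) ![s, -1, -1, -s]
      (profileHiggs φ φs m s) (profileGauge α as m s)) := by
    -- The degree bound, one step too generous, serves only to know that the error is polynomial in
    -- s.
    refine (IsSmoothPoly.weightedHiggs hD (dΦ.mono le_rfl up)
      (fun j _ => (dA j).mono le_rfl up) fun j _ => dA j).of_hasExpansion hε₀ ha.error_higgs
      fun ε hε x hx => ?_
    rw [ansatzHiggs_eq, ansatzGauge_eq]
    exact errHiggs_slow hT hε (dΦ.contDiffOn _) (fun j => (dA j).contDiffOn _) hx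
  have hG (j : Fin 2) : IsSmoothPoly (slab T) (m + 1) ⊤
      (fun s => weightedGauge (slab T) ![s, -1, -1, -s]
        (profileHiggs φ φs m s) (profileGauge α as m s) (planeIdx j)) := by
    refine (IsSmoothPoly.weightedGauge hD (dΦ.mono le_rfl up)
      (fun j => (dA j).mono le_rfl up) (planeIdx j)).of_hasExpansion hε₀ (ha.error_plane j)
      fun ε hε x hx => ?_
    rw [ansatzHiggs_eq, ansatzGauge_eq, errGauge_slow hT hε (dΦ.contDiffOn _)
      (fun j => (dA j).contDiffOn _) _ hx]
    fin_cases j <;> simp [slowFactor, planeIdx]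
  have dΦ₁ (ψ : Spacetime → ℂ) (hψ : ContDiffOn ℝ ∞ ψ (slab T)) (s : ℝ) : ContDiffOn ℝ ∞
      (fun p => profileHiggs φ φs m s p + s ^ m • ν p + s ^ (m + 1) • ψ p) (slab T) :=
    ((dΦ.contDiffOn s).add (sν.const_smul _)).add (hψ.const_smul _)
  have dA₁ (Ψ : Fin 4 → Spacetime → ℝ) (hΨ : ∀ j, ContDiffOn ℝ ∞ (Ψ j) (slab T)) (s : ℝ)
      (j : Fin 4) : ContDiffOn ℝ ∞
      (fun p => profileGauge α as m s j p + s ^ m • B j p + s ^ (m + 1) • Ψ j p) (slab T) :=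
    (((dA j).contDiffOn s).add ((sB j).const_smul _)).add ((hΨ j).const_smul _)
  have hG' : ∀ j ∈ ({0, 3} : Set (Fin 4)), IsSmoothPoly (slab T) (m + 1) ⊤ (fun s =>
      weightedGauge (slab T) ![s, -1, -1, -s] (fun p => profileHiggs φ φs m s p + s ^ m • ν p)
        (fun j p => profileGauge α as m s j p + s ^ m • B j p) j) := by
    intro j hj
    -- Removing the factor ε turns the range m + 2, …, 3(m + 1) into m + 1, …, 3m + 2 in powers of
    -- s.
    refine (IsSmoothPoly.weightedGauge hD
      ((dΦ.add (.monomial m ν (Nat.zero_le _) le_rfl sν)).mono le_rfl up)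
      (fun j => ((dA j).add (.monomial m (B j) (Nat.zero_le _) le_rfl (sB j))).mono le_rfl up)
      j).of_hasExpansion_odd hε₀ (hi := 3 * m + 2) (hb j hj) fun ε hε x hx => ?_
    have e := errGauge_slow hT hε (dΦ₁ (fun _ => 0) contDiffOn_const (ε ^ 2))
      (dA₁ (fun _ _ => 0) (fun _ => contDiffOn_const) (ε ^ 2)) j hx
    have hs : slowFactor ε j = ε := by
      rcases hj with rfl | rfl <;> rfl
    rw [stepHiggs_eq, stepGauge_eq]
    simp only [hs, smul_zero, add_zero] at e
    rw [← e]
    refine congrFun (congrArg₂ (fun Φ A => errGauge (slab (T / ε)) Φ A j) ?_ ?_) x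
    · ext y
      simp [hν]
    · ext μ y
      fin_cases μ <;> simp [hB]
  obtain ⟨Sφ, Sa, sSφ, sSa, hS, ho⟩ := exists_step_error hD hm hφ sA₀ bΦ bA dΦ dA sν sB hH hG
    (fun p hp => by rw [hA1, hA2]; exact (hL hp).1)
    (fun j p hp => by
      rw [hAk]
      have := (hL hp).2 j
      fin_cases j <;> exact this) hG'
  refine ⟨Sφ, Sa, sSφ, sSa, fun ψφ ψa hψφ hψa => ?_, (gaugeOrthogonal_slice_iff sSa).2 ho⟩
  -- The components 0 and 3 vanish here: `b₀` and `b₃` already entered at order s^m, because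
  -- ε^(2m+1) = ε s^m.
  have hΨ (j : Fin 4) : ContDiffOn ℝ ∞
      ((![fun _ => 0, ψa 0, ψa 1, fun _ => 0] : Fin 4 → Spacetime → ℝ) j) (slab T) := by
    fin_cases j
    exacts [contDiffOn_const, hψa 0, hψa 1, contDiffOn_const]
  obtain ⟨h1, h2⟩ := hS ψφ ![fun _ => 0, ψa 0, ψa 1, fun _ => 0] hψφ hΨ
    (by rintro j (rfl | rfl) <;> rfl)
  refine ⟨h1.hasExpansion fun ε hε x hx => ?_, fun j => (h2 j).hasExpansion fun ε hε x hx => ?_⟩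
  · have hp := (slow_mem_slab_iff hε).2 hx
    rw [stepHiggs_eq, stepGauge_eq]
    have e := errHiggs_slow hT hε (dΦ₁ ψφ hψφ (ε ^ 2)) (dA₁ _ hΨ (ε ^ 2)) hx
    have l := linHiggs_slice hD hφ hα hψφ hψa hp
    rw [hA1, hA2]
    refine congrArg₂ (· - ·) e ?_
    rw [show 2 * m + 2 = 2 * (m + 1) by ring, pow_mul]
    exact congrArg (fun z => (ε ^ 2) ^ (m + 1) • (z + Sφ (slow ε x))) l
  · have hp := (slow_mem_slab_iff hε).2 hx
    rw [stepHiggs_eq, stepGauge_eq]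
    have e := errGauge_slow hT hε (dΦ₁ ψφ hψφ (ε ^ 2)) (dA₁ _ hΨ (ε ^ 2)) (planeIdx j) hx
    have hs : slowFactor ε (planeIdx j) = 1 := by fin_cases j <;> rfl
    rw [hs, one_mul] at e
    have l := linGauge_slice (α := α) hD hφ hψφ hψa hp j
    refine congrArg₂ (· - ·) e ?_
    rw [show 2 * m + 2 = 2 * (m + 1) by ring, pow_mul, hAk]
    have hj : (![fun _ => 0, ψa 0, ψa 1, fun _ => 0] : Fin 4 → Spacetime → ℝ) (planeIdx j)
        = ψa j := by fin_cases j <;> rfl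
    rw [hj]
    exact congrArg (fun z => (ε ^ 2) ^ (m + 1) • (z + Sa j (slow ε x))) l

end AbelianHiggs

end

theorem mainTheorem4 :
    -- the identity between the components of `S[Φ, A]` for arbitrary smooth `(Φ, A)`
    (∀ (Φ : Spacetime → ℂ) (A : Fin 4 → Spacetime → ℝ),
      ContDiff ℝ ∞ Φ → (∀ j, ContDiff ℝ ∞ (A j)) → ∀ x,
      pairing (errHiggs Set.univ Φ A x) (Complex.I * Φ x)
        + pd Set.univ 0 (errGauge Set.univ Φ A 0) x
        - ∑ k : Fin 3, pd Set.univ k.succ (errGauge Set.univ Φ A k.succ) x = 0) ∧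
    ∀ (N : ℕ) (T : ℝ) (_hT : 0 < T) (q : ℝ × ℝ → Fin N → ℂ)
      (φ : Spacetime → ℂ) (α : Fin 2 → Spacetime → ℝ) (_hq : IsVortexLift T q φ α),
      -- the error vector `T`
      (∀ a₀ a₃ : Spacetime → ℝ,
        IsTemporalPotential T φ α 0 a₀ → IsTemporalPotential T φ α 3 a₃ →
        ∀ τ ∈ Set.Icc 0 T, ∀ ζ : ℝ,
          GaugeOrthogonal (slice φ τ ζ) (slice (errorTHiggs T φ a₀ a₃) τ ζ)
            (fun j => slice (errorTGauge T α a₀ a₃ j) τ ζ)) ∧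
      -- the vector `S_{m+1}` at the induction step from `m` to `m + 1`
      (∀ (nφ : Fin (2 * N) → Spacetime → ℂ) (na : Fin (2 * N) → Fin 2 → Spacetime → ℝ),
        IsZeroModeFrame N T φ α nφ na →
        ∀ (ε₀ : ℝ) (_hε₀ : 0 < ε₀) (m : ℕ) (_hm : 1 ≤ m)
          (φs : ℕ → Spacetime → ℂ) (as : Fin 4 → ℕ → Spacetime → ℝ),
          IsApproxSolution T ε₀ φ α m φs as →
        ∀ c : Fin (2 * N) → ℝ × ℝ → ℝ,
          (∀ μ, ContDiffOn ℝ ∞ (c μ) (Set.Icc 0 T ×ˢ Set.univ)) →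
        ∀ b₀ b₃ : Spacetime → ℝ,
          ContDiffOn ℝ ∞ b₀ (slab T) → ContDiffOn ℝ ∞ b₃ (slab T) →
          -- `b₀ = a_{0,m+1}` and `b₃ = a_{3,m+1}` make `S_{a_0}` and `S_{a_3}` of order `ε^{2m+3}`
          (∀ j ∈ ({0, 3} : Set (Fin 4)), HasExpansion T ε₀
            (fun ε => errGauge (slab (T / ε)) (stepHiggs φ φs m c nφ 0 ε)
              (stepGauge α as m c na b₀ b₃ 0 ε) j)
            (fun i => 2 * i - 1) (m + 2) (3 * (m + 1))) →
        ∃ (Sφ : Spacetime → ℂ) (Sa : Fin 2 → Spacetime → ℝ),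
          ContDiffOn ℝ ∞ Sφ (slab T) ∧ (∀ j, ContDiffOn ℝ ∞ (Sa j) (slab T)) ∧
          IsStepError T ε₀ φ α m φs as c nφ na b₀ b₃ Sφ Sa ∧
          ∀ τ ∈ Set.Icc 0 T, ∀ ζ : ℝ,
            GaugeOrthogonal (slice φ τ ζ) (slice Sφ τ ζ) (fun j => slice (Sa j) τ ζ)) := by
  refine ⟨fun Φ A hΦ hA x => ?_, fun N T hT q φ α hq => ⟨fun a₀ a₃ h₀ h₃ => ?_, ?_⟩⟩
  · have h := regularDomain_univ.gauge_identity ![1, -1, -1, -1] hΦ.contDiffOn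
      (fun j => (hA j).contDiffOn) (Set.mem_univ x)
    simp only [errHiggs_eq_weightedHiggs, errGauge_eq_weightedGauge]
    simp only [Fin.sum_univ_succ] at h ⊢
    simp at h ⊢
    linarith
  · exact gaugeOrthogonal_errorT hT hq h₀ h₃
  · intro nφ na hn ε₀ hε₀ m hm φs as ha c hc b₀ b₃ hb₀ hb₃ hb
    exact exists_isStepError hT hq hn hε₀ hm ha hc hb₀ hb₃ hb
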